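/- Let $q\in\mathbb C$ with $0<|q|<1$, and write $(a;q)_n=\prod_{i=0}^{n-1}(1-aq^i)$, $(a;q)_\infty=\prod_{i\ge 0}(1-aq^i)$, $(a_1,\dots,a_k;q)_n=(a_1;q)_n\cdots(a_k;q)_n$ for $n\in\{0,1,2,\dots\}\cup\{\infty\}$, $\Omega_q=\{q^{-k}:k=0,1,2,\dots\}$, and $$ {}_{r+1}\phi_s\!\left({a_1,\dots,a_{r+1}\atop b_1,\dots,b_s};q,z\right)=\sum_{k\ge 0}\frac{(a_1,\dots,a_{r+1};q)_k}{(q,b_1,\dots,b_s;q)_k}\left((-1)^kq^{\binom k2}\right)^{s-r}z^k . $$ For $x=\cos\theta\in[-1,1]$ with $\theta\in\mathbb R$, let $$ p_n(x;a,b,c|q)=a^{-n}(ab,ac;q)_n\;{}_3\phi_2\!\left({q^{-n},ae^{i\theta},ae^{-i\theta}\atop ab,ac};q,q\right) $$ be the continuous dual $q$-Hahn polynomials. **Theorem.** Let $\gamma\in\mathbb C$ and $t,a,b,c\in\mathbb C\setminus\{0\}$ with $|t|<1$, and let $x=\cos\theta$ with $\theta\in\mathbb R$. Assume that $ab,ac,tb,tc\notin\Omega_q$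 and that $t/a\neq q^m$ for all $m\in\mathbb Z$. Then the three series below converge absolutely, and $$ \sum_{n=0}^\infty\frac{(\gamma;q)_n\,p_n(x;a,b,c|q)}{(q,ab,ac;q)_n}\,t^n =\frac{(\gamma t/a;q)_\infty}{(t/a;q)_\infty}\;{}_4\phi_3\!\left({\gamma,ae^{i\theta},ae^{-i\theta},0\atop ab,ac,qa/t};q,q\right) $$ $$ \qquad+\frac{(ae^{i\theta},ae^{-i\theta},tb,tc,\gamma;q)_\infty}{(ab,ac,te^{i\theta},te^{-i\theta},a/t;q)_\infty}\;{}_4\phi_3\!\left({\gamma t/a,te^{i\theta},te^{-i\theta},0\atop tb,tc,qt/a};q,q\right). $$ -/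

import Mathlib

/-- The finite `q`-shifted factorial `(a;q)_n = (1 - a)(1 - a q) ⋯ (1 - a q^(n-1))`. -/
noncomputable def qPoch (a q : ℂ) (n : ℕ) : ℂ :=
  ∏ i ∈ Finset.range n, (1 - a * q ^ i)

/-- The infinite `q`-shifted factorial `(a;q)_∞ = ∏_{n ≥ 0} (1 - a q^n)`, for `|q| < 1`. -/
noncomputable def qPochInf (a q : ℂ) : ℂ :=
  ∏' n : ℕ, (1 - a * q ^ n)

/-- The product defining `(a;q)_∞` converges when `|q| < 1`. -/
theorem hasProd_qPochInf (a q : ℂ) (hq : ‖q‖ < 1) :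
    HasProd (fun n : ℕ => 1 - a * q ^ n) (qPochInf a q) := by
  have h : Summable fun n : ℕ => ‖-(a * q ^ n)‖ := by
    simpa [norm_mul, norm_pow] using
      (summable_geometric_of_lt_one (norm_nonneg q) hq).mul_left ‖a‖
  have h2 := (multipliable_one_add_of_summable h).hasProd
  simpa [qPochInf, sub_eq_add_neg] using h2

/-- `(a₁, …, a_k; q)_n = (a₁;q)_n ⋯ (a_k;q)_n`. -/
noncomputable def qPochs (l : List ℂ) (q : ℂ) (n : ℕ) : ℂ :=
  (l.map fun a => qPoch a q n).prod

/-- `(a₁, …, a_k; q)_∞ = (a₁;q)_∞ ⋯ (a_k;q)_∞`. -/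
noncomputable def qPochInfs (l : List ℂ) (q : ℂ) : ℂ :=
  (l.map fun a => qPochInf a q).prod

/-- The set `Ω_q = {q^(-k) : k = 0, 1, 2, …}`. -/
def OmegaSet (q : ℂ) : Set ℂ :=
  Set.range fun k : ℕ => (q ^ k)⁻¹

/-- The `k`-th term of the basic hypergeometric series with numerator parameters `as`
(`r + 1` of them), denominator parameters `bs` (`s` of them), base `q` and argument `z`:
`(a₁,…,a_{r+1};q)_k / (q,b₁,…,b_s;q)_k * ((-1)^k q^(k(k-1)/2))^(s-r) * z^k`. -/
noncomputable def qHypTerm (as bs : List ℂ) (q z : ℂ) (k : ℕ) : ℂ :=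
  qPochs as q k / qPochs (q :: bs) q k
    * ((-1) ^ k * q ^ (k.choose 2)) ^ ((bs.length : ℤ) + 1 - (as.length : ℤ)) * z ^ k

/-- The basic hypergeometric series `_{r+1}φ_s(as; bs; q, z)`. -/
noncomputable def qHyp (as bs : List ℂ) (q z : ℂ) : ℂ :=
  ∑' k : ℕ, qHypTerm as bs q z k

/-- The value at `x = cos θ`, given through `θ`, of the continuous dual `q`-Hahn polynomial:
`a^(-n) (ab,ac;q)_n ₃φ₂(q^(-n), a e^(iθ), a e^(-iθ); ab, ac; q, q)`. -/
noncomputable def contDualQHahnTheta (n : ℕ) (θ : ℝ) (a b c q : ℂ) : ℂ :=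
  (a ^ n)⁻¹ * qPochs [a * b, a * c] q n *
    qHyp [(q ^ n)⁻¹, a * Complex.exp (Complex.I * θ), a * Complex.exp (-(Complex.I * θ))]
      [a * b, a * c] q q

/-- The continuous dual `q`-Hahn polynomial `p_n(x; a, b, c | q)` for `x ∈ [-1, 1]`. -/
noncomputable def contDualQHahn (n : ℕ) (x : ℝ) (a b c q : ℂ) : ℂ :=
  contDualQHahnTheta n (Real.arccos x) a b c q

/-- The value does not depend on the choice of `θ` with `x = cos θ`. -/
theorem contDualQHahn_cos (n : ℕ) (θ : ℝ) (a b c q : ℂ) :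
    contDualQHahn n (Real.cos θ) a b c q = contDualQHahnTheta n θ a b c q := by
  have hcos : Real.cos (Real.arccos (Real.cos θ)) = Real.cos θ :=
    Real.cos_arccos (Real.neg_one_le_cos θ) (Real.cos_le_one θ)
  unfold contDualQHahn
  generalize Real.arccos (Real.cos θ) = φ at hcos
  obtain ⟨k, hk⟩ := Real.cos_eq_cos_iff.1 hcos
  have e1 : Complex.exp (Complex.I * (2 * k * Real.pi : ℝ)) = 1 := by
    rw [Complex.exp_eq_one_iff]
    exact ⟨k, by push_cast; ring⟩
  have e2 : Complex.exp (-(Complex.I * (2 * k * Real.pi : ℝ))) = 1 := by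
    rw [Complex.exp_neg, e1, inv_one]
  rcases hk with h | h
  · subst h
    unfold contDualQHahnTheta
    simp only [Complex.ofReal_add, mul_add, neg_add, Complex.exp_add, e1, e2, one_mul]
  · subst h
    unfold contDualQHahnTheta
    simp only [Complex.ofReal_sub, mul_sub, neg_sub, Complex.exp_sub, e1, div_one, one_div, Complex.exp_neg]
    congr 1
    unfold qHyp qHypTerm qPochs
    simp only [List.map_cons, List.map_nil, List.prod_cons, List.prod_nil, List.length_cons,
      List.length_nil]
    refine tsum_congr fun j => ?_
    ring

/-! Put τ = t/a and z₁, z₂ = e^{±iθ}. The terminating ₃φ₂ is a q-binomial sum, so up to explicit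
factors p_n is the n-th normalised q-difference at 0 of the sequence u_k = (az₁, az₂;q)_k / (ab,
ac;q)_k (`contDualQHahnTheta_eq_qDiff`). Formally u_k = G(aq^k)/G(a) with G(x) = (xb, xc;q)_∞ /
(xz₁, xz₂;q)_∞, and the second ₄φ₃ is made of the values G(tq^k). The theorem thus says that a
series of q-differences of G equals a q-integral over the two sequences aq^k and tq^k
(`tsum_qDiff_eq`).

Both sides are linear in G, so monomials x^m decide. The differences give a Rogers–Szegő type
polynomial, the q-integral a combination of two ₂φ₁ series, and both satisfy one three-term
recurrence in m (`qMoment_eq_rogersSzego`). The starting value is a degenerate nonterminating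
q-Chu–Vandermonde sum, obtained in `qMoment_zero` from invariance under γ ↦ γq.

Summing over monomials requires G to be analytic on a disc large compared with |a| and |t|, which
forces z₁, z₂ to be small (`tsum_qDiff_qPoch_of_small`). Unit modulus is reached by analytic
continuation in s along (sz₁, sz₂), from s near 0 to s = 1 (`tsum_qDiff_qPoch`). The estimate
`exists_norm_qDiff_le` supplies the uniform convergence, and |t| < 1 leaves room for a disc
containing s = 1. -/

open Filter Topology

/-! ### q-shifted factorials: bounds, limits, zeros, analyticity. -/

theorem qPoch_zero (a q : ℂ) : qPoch a q 0 = 1 := by simp [qPoch]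

theorem qPoch_succ (a q : ℂ) (n : ℕ) :
    qPoch a q (n + 1) = qPoch a q n * (1 - a * q ^ n) := by
  simp [qPoch, Finset.prod_range_succ]

theorem qPoch_succ' (a q : ℂ) (n : ℕ) :
    qPoch a q (n + 1) = (1 - a) * qPoch (a * q) q n := by
  simp only [qPoch, Finset.prod_range_succ', pow_zero, mul_one, mul_comm _ (1 - a)]
  congr 1
  exact Finset.prod_congr rfl fun i _ => by ring

theorem qPoch_zero_left (q : ℂ) (n : ℕ) : qPoch 0 q n = 1 := by simp [qPoch]

theorem norm_sum_geometric_le {q : ℂ} (hq : ‖q‖ < 1) (n : ℕ) :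
    ∑ i ∈ Finset.range n, ‖q‖ ^ i ≤ (1 - ‖q‖)⁻¹ := by
  rw [← tsum_geometric_of_lt_one (norm_nonneg q) hq]
  exact (summable_geometric_of_lt_one (norm_nonneg q) hq).sum_le_tsum _ fun i _ => by positivity

/-- A bound for the homogeneous `q`-shifted factorial `∏ (x - y q^i)`. -/
theorem norm_prod_sub_mul_pow_le {q : ℂ} (hq : ‖q‖ < 1) {x y : ℂ} {ρ Y : ℝ} (hρ : 0 < ρ)
    (hx : ‖x‖ ≤ ρ) (hy : ‖y‖ ≤ Y) (n : ℕ) :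
    ‖∏ i ∈ Finset.range n, (x - y * q ^ i)‖ ≤ ρ ^ n * Real.exp (Y / ρ * (1 - ‖q‖)⁻¹) := by
  have hY : 0 ≤ Y := (norm_nonneg y).trans hy
  have h1 : ∀ i ∈ Finset.range n, ‖x - y * q ^ i‖ ≤ ρ * (1 + Y / ρ * ‖q‖ ^ i) := by
    intro i _
    refine (norm_sub_le _ _).trans ?_
    rw [norm_mul, norm_pow]
    have : ρ * (1 + Y / ρ * ‖q‖ ^ i) = ρ + Y * ‖q‖ ^ i := by field_simp
    rw [this]
    gcongr
  rw [norm_prod]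
  refine (Finset.prod_le_prod (fun i _ => norm_nonneg _) h1).trans ?_
  rw [Finset.prod_mul_distrib, Finset.prod_const, Finset.card_range]
  gcongr
  refine (Real.prod_one_add_le_exp_sum _ fun i => by positivity).trans ?_
  rw [← Finset.mul_sum]
  gcongr
  exact norm_sum_geometric_le hq n

theorem norm_qPoch_le {q : ℂ} (hq : ‖q‖ < 1) {a : ℂ} {R : ℝ} (ha : ‖a‖ ≤ R) (n : ℕ) :
    ‖qPoch a q n‖ ≤ Real.exp (R * (1 - ‖q‖)⁻¹) := by
  simpa [qPoch] using norm_prod_sub_mul_pow_le hq (x := 1) one_pos (by simp) ha n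

theorem tendsto_qPoch (a : ℂ) {q : ℂ} (hq : ‖q‖ < 1) :
    Tendsto (qPoch a q) atTop (𝓝 (qPochInf a q)) :=
  (hasProd_qPochInf a q hq).tendsto_prod_nat

theorem qPoch_mul_qPochInf (a : ℂ) {q : ℂ} (hq : ‖q‖ < 1) (k : ℕ) :
    qPoch a q k * qPochInf (a * q ^ k) q = qPochInf a q := by
  have h1 : Tendsto (fun n => qPoch a q k * qPoch (a * q ^ k) q n) atTop
      (𝓝 (qPoch a q k * qPochInf (a * q ^ k) q)) := (tendsto_qPoch _ hq).const_mul _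
  have h2 := (tendsto_add_atTop_iff_nat k).2 (tendsto_qPoch a hq)
  refine tendsto_nhds_unique h1 (h2.congr fun n => ?_)
  rw [qPoch, add_comm, Finset.prod_range_add]
  simp only [qPoch]
  congr 1
  exact Finset.prod_congr rfl fun i _ => by ring

theorem qPochInf_eq_one_sub_mul (a : ℂ) {q : ℂ} (hq : ‖q‖ < 1) :
    qPochInf a q = (1 - a) * qPochInf (a * q) q := by
  rw [← qPoch_mul_qPochInf a hq 1]; simp [qPoch]

theorem qPochInf_one_left {q : ℂ} (hq : ‖q‖ < 1) : qPochInf 1 q = 0 := by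
  rw [qPochInf_eq_one_sub_mul 1 hq]; simp

theorem one_sub_mul_pow_ne_zero {a q : ℂ} (ha : a ∉ OmegaSet q) (k : ℕ) :
    1 - a * q ^ k ≠ 0 := fun h =>
  ha ⟨k, (eq_inv_of_mul_eq_one_left (sub_eq_zero.1 h).symm).symm⟩

theorem qPoch_ne_zero {a q : ℂ} (ha : a ∉ OmegaSet q) (n : ℕ) : qPoch a q n ≠ 0 :=
  Finset.prod_ne_zero_iff.2 fun i _ => one_sub_mul_pow_ne_zero ha i

theorem qPochInf_ne_zero {a q : ℂ} (hq : ‖q‖ < 1) (ha : a ∉ OmegaSet q) :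
    qPochInf a q ≠ 0 := by
  have := tprod_one_add_ne_zero_of_summable (f := fun n : ℕ => -(a * q ^ n))
    (fun i => by simpa [sub_eq_add_neg] using one_sub_mul_pow_ne_zero ha i)
    (by simpa [norm_mul, norm_pow] using
      (summable_geometric_of_lt_one (norm_nonneg q) hq).mul_left ‖a‖)
  simpa [qPochInf, sub_eq_add_neg] using this

theorem not_mem_OmegaSet_of_norm_lt_one {a q : ℂ} (hq0 : q ≠ 0) (hq : ‖q‖ < 1) (ha : ‖a‖ < 1) :
    a ∉ OmegaSet q := by
  rintro ⟨k, rfl⟩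
  rw [norm_inv, norm_pow] at ha
  have h0 : 0 < ‖q‖ ^ k := by positivity
  have h1 : ‖q‖ ^ k ≤ 1 := pow_le_one₀ (norm_nonneg q) hq.le
  exact absurd ha (not_lt.2 ((one_le_inv₀ h0).2 h1))

theorem not_mem_OmegaSet_of_zpow {a q : ℂ} (ha : ∀ m : ℤ, a ≠ q ^ m) : a ∉ OmegaSet q := by
  rintro ⟨k, rfl⟩
  exact ha (-k) (by simp)

/-- The reciprocals of `(a;q)_n` are bounded if none of them has a pole. -/
theorem exists_norm_inv_qPoch_le {a q : ℂ} (hq : ‖q‖ < 1) (ha : a ∉ OmegaSet q) :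
    ∃ C : ℝ, 0 < C ∧ ∀ n, ‖(qPoch a q n)⁻¹‖ ≤ C := by
  have h := ((tendsto_qPoch a hq).inv₀ (qPochInf_ne_zero hq ha)).norm
  obtain ⟨C, hC⟩ := h.bddAbove_range
  exact ⟨max C 1, by positivity, fun n => (hC ⟨n, rfl⟩).trans (le_max_left _ _)⟩

theorem differentiable_qPochInf {q : ℂ} (hq : ‖q‖ < 1) :
    Differentiable ℂ fun a => qPochInf a q := by
  intro a
  have hs : Summable fun n : ℕ => (‖a‖ + 1) * ‖q‖ ^ n :=
    (summable_geometric_of_lt_one (norm_nonneg q) hq).mul_left _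
  have h := hs.hasProdLocallyUniformlyOn_nat_one_add
    (f := fun n (x : ℂ) => -(x * q ^ n)) (K := Metric.ball 0 (‖a‖ + 1)) Metric.isOpen_ball
    (.of_forall fun n x hx => by
      rw [norm_neg, norm_mul, norm_pow]
      gcongr
      simpa using (Metric.mem_ball.1 hx).le) (fun n => by fun_prop)
  have hd := h.differentiableOn (.of_forall fun s => by
    simpa [Finset.prod_fn] using
      DifferentiableOn.finsetProd (fun _ _ ↦ by fun_prop)) Metric.isOpen_ball
  have := hd.differentiableAt (Metric.isOpen_ball.mem_nhds (x := a) (by simp))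
  simpa [qPochInf, sub_eq_add_neg] using this

theorem differentiable_qPoch (q : ℂ) (n : ℕ) : Differentiable ℂ fun a => qPoch a q n := by
  unfold qPoch
  exact Differentiable.fun_finsetProd fun i _ => by fun_prop

theorem one_sub_pow_succ_ne_zero {q : ℂ} (hq : ‖q‖ < 1) (n : ℕ) : 1 - q ^ (n + 1) ≠ 0 := by
  intro h
  have h1 : ‖q ^ (n + 1)‖ = 1 := by rw [← sub_eq_zero.1 h]; simp
  rw [norm_pow] at h1
  exact absurd h1 (pow_lt_one₀ (norm_nonneg q) hq (by simp)).ne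

theorem qPoch_self_succ (q : ℂ) (n : ℕ) :
    qPoch q q (n + 1) = qPoch q q n * (1 - q ^ (n + 1)) := by
  rw [qPoch_succ, pow_succ']

theorem qPoch_self_ne_zero {q : ℂ} (hq : ‖q‖ < 1) (n : ℕ) : qPoch q q n ≠ 0 := by
  refine Finset.prod_ne_zero_iff.2 fun i _ => ?_
  rw [← pow_succ']
  exact one_sub_pow_succ_ne_zero hq i

/-! ### Normalised q-differences. -/

/-- The normalised iterated `q`-difference `(1 - q^(1-n) E) ⋯ (1 - q^(-1) E) (1 - E) u / (q;q)_n`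
of a sequence, where `E` is the shift. -/
noncomputable def qDiff (q : ℂ) : ℕ → (ℕ → ℂ) → ℕ → ℂ
  | 0, u, k => u k
  | n + 1, u, k => (qDiff q n u k - (q ^ n)⁻¹ * qDiff q n u (k + 1)) / (1 - q ^ (n + 1))

theorem one_sub_mul_qDiff_succ {q : ℂ} (hq : ‖q‖ < 1) (n : ℕ) (u : ℕ → ℂ) (k : ℕ) :
    (1 - q ^ (n + 1)) * qDiff q (n + 1) u k
      = qDiff q n u k - (q ^ n)⁻¹ * qDiff q n u (k + 1) := by
  rw [qDiff, mul_div_cancel₀ _ (one_sub_pow_succ_ne_zero hq n)]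

theorem qDiff_const_mul (q c : ℂ) (n : ℕ) (u : ℕ → ℂ) (k : ℕ) :
    qDiff q n (fun j => c * u j) k = c * qDiff q n u k := by
  induction n generalizing k with
  | zero => rfl
  | succ n ih => simp only [qDiff, ih]; ring

theorem hasSum_qDiff {ι : Type*} (q : ℂ) {f : ι → ℕ → ℂ} {u : ℕ → ℂ}
    (h : ∀ k, HasSum (fun m => f m k) (u k)) (n k : ℕ) :
    HasSum (fun m => qDiff q n (f m) k) (qDiff q n u k) := by
  induction n generalizing k with
  | zero => exact h k
  | succ n ih => exact ((ih k).sub ((ih (k + 1)).mul_left _)).div_const _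

/-- The coefficients obey a q-Pascal rule (`key`). At j = 0 this is the bridge from differences to
the terminating series in the polynomials. -/
theorem qDiff_eq_sum {q : ℂ} (hq0 : q ≠ 0) (hq : ‖q‖ < 1) (n : ℕ) (u : ℕ → ℂ) (j : ℕ) :
    qDiff q n u j = ∑ k ∈ Finset.range (n + 1),
      qPoch (q ^ n)⁻¹ q k / qPoch q q k * q ^ k * u (j + k) / qPoch q q n := by
  induction n generalizing j with
  | zero => simp [qDiff, qPoch]
  | succ n ih =>
    have hn := qPoch_self_ne_zero hq n
    have hn1 := one_sub_pow_succ_ne_zero hq n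
    have hqn : q ^ n ≠ 0 := pow_ne_zero _ hq0
    have hvan : qPoch (q ^ n)⁻¹ q (n + 1) = 0 := by
      rw [qPoch_succ, inv_mul_cancel₀ hqn]; simp
    have key : ∀ k, qPoch (q ^ (n + 1))⁻¹ q (k + 1) / qPoch q q (k + 1) * q ^ (k + 1)
        = qPoch (q ^ n)⁻¹ q (k + 1) / qPoch q q (k + 1) * q ^ (k + 1)
          - (q ^ n)⁻¹ * (qPoch (q ^ n)⁻¹ q k / qPoch q q k * q ^ k) := by
      intro k
      have hk := qPoch_self_ne_zero hq k
      have hk1 := one_sub_pow_succ_ne_zero hq k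
      have e : (q ^ (n + 1))⁻¹ * q = (q ^ n)⁻¹ := by rw [pow_succ]; field_simp
      rw [qPoch_succ' (q ^ (n + 1))⁻¹, e, qPoch_succ (q ^ n)⁻¹, qPoch_self_succ, pow_succ q n]
      field_simp
      ring
    rw [qDiff, ih, ih, Finset.sum_range_succ' _ (n + 1)]
    have e1 : ∑ k ∈ Finset.range (n + 1),
        qPoch (q ^ n)⁻¹ q k / qPoch q q k * q ^ k * u (j + k) / qPoch q q n
        = ∑ k ∈ Finset.range (n + 1),
          qPoch (q ^ n)⁻¹ q (k + 1) / qPoch q q (k + 1) * q ^ (k + 1) * u (j + (k + 1))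
            / qPoch q q n + u j / qPoch q q n := by
      have := Finset.sum_range_succ (fun k =>
        qPoch (q ^ n)⁻¹ q k / qPoch q q k * q ^ k * u (j + k) / qPoch q q n) (n + 1)
      rw [hvan] at this
      simp only [zero_div, zero_mul, add_zero] at this
      rw [← this, Finset.sum_range_succ']
      simp [qPoch_zero]
    rw [e1, Finset.mul_sum, add_sub_right_comm, ← Finset.sum_sub_distrib, add_div,
      Finset.sum_div]
    congr 1
    · refine Finset.sum_congr rfl fun k _ => ?_
      rw [key, qPoch_self_succ q n, show j + 1 + k = j + (k + 1) by ring]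
      field_simp
    · simp only [qPoch_zero, qPoch_self_succ q n]
      field_simp
      simp

/-- A form of q-Chu–Vandermonde. The homogeneous product on the right shows the decay in n, which
the alternating sum hides behind large powers of q⁻¹. -/
theorem qDiff_qPoch_div {q : ℂ} (hq : ‖q‖ < 1) (hq0 : q ≠ 0) (x : ℂ) {y : ℂ}
    (hy : y ∉ OmegaSet q) (n k : ℕ) :
    qDiff q n (fun k => qPoch x q k / qPoch y q k) k
      = qPoch x q k / qPoch y q (k + n) * q ^ (k * n)
        * (∏ i ∈ Finset.range n, (x - y * q ^ i)) / qPoch q q n := by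
  induction n generalizing k with
  | zero => simp [qDiff, qPoch_zero]
  | succ n ih =>
    have h1 := qPoch_ne_zero hy (k + n)
    have h2 := one_sub_mul_pow_ne_zero hy (k + n)
    have h3 := one_sub_pow_succ_ne_zero hq n
    have h4 := qPoch_self_ne_zero hq n
    rw [qDiff, ih, ih, show k + 1 + n = (k + n) + 1 by ring, show k + (n + 1) = (k + n) + 1 by ring,
      qPoch_succ y, qPoch_succ x, qPoch_self_succ, Finset.prod_range_succ,
      add_mul, pow_add q (k * n), one_mul, mul_add, pow_add q (k * n), mul_one]
    rw [pow_add] at h2 ⊢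
    obtain ⟨D, hD⟩ : ∃ D, D = 1 - y * (q ^ k * q ^ n) := ⟨_, rfl⟩
    rw [← hD] at h2 ⊢
    field_simp
    linear_combination (∏ i ∈ Finset.range n, (x - y * q ^ i)) * qPoch x q k * hD

/-- Geometric sequences are eigenvectors of the shift, so each difference factor contributes a
scalar. -/
theorem qDiff_pow (q : ℂ) (m n k : ℕ) :
    qDiff q n (fun k => q ^ (m * k)) k
      = q ^ (m * k) * (∏ j ∈ Finset.range n, (1 - q ^ m * (q ^ j)⁻¹)) / qPoch q q n := by
  induction n generalizing k with
  | zero => simp [qDiff, qPoch_zero]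
  | succ n ih =>
    rw [qDiff, ih, ih, Finset.prod_range_succ, qPoch_self_succ, mul_add, pow_add, mul_one,
      ← div_div]
    ring

/-- The Leibniz rule for normalised `q`-differences. -/
theorem qDiff_mul {q : ℂ} (hq0 : q ≠ 0) (hq : ‖q‖ < 1) (n : ℕ) (u v : ℕ → ℂ) (j : ℕ) :
    qDiff q n (fun k => u k * v k) j = ∑ p ∈ Finset.HasAntidiagonal.antidiagonal n,
      (q ^ (p.1 * p.2))⁻¹ * qDiff q p.1 u (j + p.2) * qDiff q p.2 v j := by
  induction n generalizing j with
  | zero => simp [qDiff]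
  | succ n ih =>
    have hn1 := one_sub_pow_succ_ne_zero hq n
    rw [qDiff, div_eq_iff hn1, ih, ih, mul_comm _ (1 - _), Finset.mul_sum, Finset.mul_sum]
    -- Uses 1 - q^(i+l) = q^l (1 - q^i) + (1 - q^l): each piece lowers the order of one of the two
    -- differences.
    have split : ∀ p ∈ Finset.HasAntidiagonal.antidiagonal (n + 1),
        (1 - q ^ (n + 1)) * ((q ^ (p.1 * p.2))⁻¹ * qDiff q p.1 u (j + p.2) * qDiff q p.2 v j)
        = q ^ p.2 * (q ^ (p.1 * p.2))⁻¹ * ((1 - q ^ p.1) * qDiff q p.1 u (j + p.2))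
            * qDiff q p.2 v j
          + (q ^ (p.1 * p.2))⁻¹ * qDiff q p.1 u (j + p.2)
            * ((1 - q ^ p.2) * qDiff q p.2 v j) := by
      intro p hp
      rw [← Finset.HasAntidiagonal.mem_antidiagonal.1 hp, pow_add]
      ring
    rw [Finset.sum_congr rfl split, Finset.sum_add_distrib, Finset.Nat.sum_antidiagonal_succ,
      Finset.Nat.sum_antidiagonal_succ' (f := fun p : ℕ × ℕ =>
        (q ^ (p.1 * p.2))⁻¹ * qDiff q p.1 u (j + p.2) * ((1 - q ^ p.2) * qDiff q p.2 v j))]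
    simp only [pow_zero, sub_self, zero_mul, mul_zero, zero_add, one_sub_mul_qDiff_succ hq]
    rw [← Finset.sum_sub_distrib, ← Finset.sum_add_distrib]
    refine Finset.sum_congr rfl fun p hp => ?_
    obtain ⟨i, l⟩ := p
    obtain rfl := (Finset.HasAntidiagonal.mem_antidiagonal.1 hp).symm
    have hi : q ^ i ≠ 0 := pow_ne_zero _ hq0
    have hl : q ^ l ≠ 0 := pow_ne_zero _ hq0
    have hil : q ^ (i * l) ≠ 0 := pow_ne_zero _ hq0
    simp only [add_mul, mul_add, one_mul, mul_one, pow_add,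
      show j + l + 1 = j + 1 + l by ring, show j + (l + 1) = j + 1 + l by ring]
    field_simp
    ring

/-- In the Leibniz rule the dangerous factor q^(-il) cancels the q^(li) produced by differencing the
first quotient at shift l. Each of the n + 1 remaining products is O(ρ^n), uniformly in x₁ and x₂.
-/
theorem exists_norm_qDiff_le {q : ℂ} (hq0 : q ≠ 0) (hq : ‖q‖ < 1) {y₁ y₂ : ℂ}
    (hy₁ : y₁ ∉ OmegaSet q) (hy₂ : y₂ ∉ OmegaSet q) {ρ : ℝ} (hρ : 0 < ρ) :
    ∃ C : ℝ, 0 < C ∧ ∀ x₁ x₂ : ℂ, ‖x₁‖ ≤ ρ → ‖x₂‖ ≤ ρ → ∀ n : ℕ,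
      ‖qDiff q n (fun k => qPoch x₁ q k / qPoch y₁ q k * (qPoch x₂ q k / qPoch y₂ q k)) 0‖
        ≤ C * ((n + 1) * ρ ^ n) := by
  obtain ⟨C₁, hC₁, h₁⟩ := exists_norm_inv_qPoch_le hq hy₁
  obtain ⟨C₂, hC₂, h₂⟩ := exists_norm_inv_qPoch_le hq hy₂
  obtain ⟨C₃, hC₃, h₃⟩ := exists_norm_inv_qPoch_le hq
    (not_mem_OmegaSet_of_norm_lt_one hq0 hq hq)
  set s := (1 - ‖q‖)⁻¹
  refine ⟨Real.exp (ρ * s) * C₁ * Real.exp (‖y₁‖ / ρ * s) * C₃ * (C₂ *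
    Real.exp (‖y₂‖ / ρ * s) * C₃), by positivity, fun x₁ x₂ hx₁ hx₂ n => ?_⟩
  rw [qDiff_mul hq0 hq]
  have hb : ∀ p ∈ Finset.HasAntidiagonal.antidiagonal n,
      ‖(q ^ (p.1 * p.2))⁻¹ * qDiff q p.1 (fun k => qPoch x₁ q k / qPoch y₁ q k) (0 + p.2)
        * qDiff q p.2 (fun k => qPoch x₂ q k / qPoch y₂ q k) 0‖
      ≤ Real.exp (ρ * s) * C₁ * Real.exp (‖y₁‖ / ρ * s) * C₃ * (C₂ *
    Real.exp (‖y₂‖ / ρ * s) * C₃) * ρ ^ n := by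
    rintro ⟨i, l⟩ hp
    obtain rfl := (Finset.HasAntidiagonal.mem_antidiagonal.1 hp).symm
    have hil : q ^ (i * l) ≠ 0 := pow_ne_zero _ hq0
    have e : (q ^ (i * l))⁻¹ * qDiff q i (fun k => qPoch x₁ q k / qPoch y₁ q k) (0 + l)
        * qDiff q l (fun k => qPoch x₂ q k / qPoch y₂ q k) 0
        = qPoch x₁ q l * (qPoch y₁ q (l + i))⁻¹ * (∏ r ∈ Finset.range i, (x₁ - y₁ * q ^ r))
            * (qPoch q q i)⁻¹ * ((qPoch y₂ q l)⁻¹ * (∏ r ∈ Finset.range l, (x₂ - y₂ * q ^ r))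
            * (qPoch q q l)⁻¹) := by
      rw [qDiff_qPoch_div hq hq0 _ hy₁, qDiff_qPoch_div hq hq0 _ hy₂, mul_comm i l]
      rw [mul_comm i l] at hil
      simp only [zero_add, zero_mul, pow_zero, qPoch_zero]
      field_simp
    dsimp only
    rw [e]
    simp only [norm_mul]
    calc _ ≤ Real.exp (ρ * s) * C₁ * (ρ ^ i * Real.exp (‖y₁‖ / ρ * s)) * C₃ * (C₂ *
          (ρ ^ l * Real.exp (‖y₂‖ / ρ * s)) * C₃) := by
          gcongr
          · exact norm_qPoch_le hq hx₁ l
          · exact h₁ _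
          · exact norm_prod_sub_mul_pow_le hq hρ hx₁ le_rfl i
          · exact h₃ _
          · exact h₂ _
          · exact norm_prod_sub_mul_pow_le hq hρ hx₂ le_rfl l
          · exact h₃ _
      _ = _ := by rw [pow_add]; ring
  refine (norm_sum_le_of_le _ hb).trans (le_of_eq ?_)
  simp
  ring

theorem hasSum_of_eq {f g : ℕ → ℂ} {s : ℂ} (h : HasSum g s) (e : ∀ k, f k = g k) :
    HasSum f s := by
  rwa [funext e]

/-! ### The series ₂φ₁(γ, 0; β; q, Z) and its contiguity relations. -/

/-- The coefficients of the basic hypergeometric series `₂φ₁(γ, 0; β; q, Z)`. -/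
noncomputable def phiCoeff (γ β q : ℂ) (k : ℕ) : ℂ :=
  qPoch γ q k / (qPoch q q k * qPoch β q k)

/-- The basic hypergeometric series `₂φ₁(γ, 0; β; q, Z)`. -/
noncomputable def phiSum (γ β q Z : ℂ) : ℂ :=
  ∑' k : ℕ, phiCoeff γ β q k * Z ^ k

theorem exists_norm_phiCoeff_le {β q : ℂ} (hq0 : q ≠ 0) (hq : ‖q‖ < 1) (hβ : β ∉ OmegaSet q)
    (R : ℝ) : ∃ C : ℝ, 0 < C ∧ ∀ γ : ℂ, ‖γ‖ ≤ R → ∀ k, ‖phiCoeff γ β q k‖ ≤ C := by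
  obtain ⟨C₁, hC₁, h₁⟩ := exists_norm_inv_qPoch_le hq hβ
  obtain ⟨C₂, hC₂, h₂⟩ := exists_norm_inv_qPoch_le hq
    (not_mem_OmegaSet_of_norm_lt_one hq0 hq hq)
  refine ⟨Real.exp (R * (1 - ‖q‖)⁻¹) * (C₂ * C₁), by positivity, fun γ hγ k => ?_⟩
  rw [phiCoeff, div_eq_mul_inv, mul_inv, norm_mul, norm_mul]
  gcongr
  · exact norm_qPoch_le hq hγ k
  · exact h₂ k
  · exact h₁ k

section
variable {γ β q : ℂ} (hq0 : q ≠ 0) (hq : ‖q‖ < 1)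
include hq0 hq

theorem summable_phiCoeff (hβ : β ∉ OmegaSet q) (γ : ℂ) {Z : ℂ} (hZ : ‖Z‖ < 1) :
    Summable fun k => phiCoeff γ β q k * Z ^ k := by
  obtain ⟨C, hC, h⟩ := exists_norm_phiCoeff_le hq0 hq hβ ‖γ‖
  refine Summable.of_norm_bounded
    ((summable_geometric_of_lt_one (norm_nonneg Z) hZ).mul_left C) fun k => ?_
  rw [norm_mul, norm_pow]
  gcongr
  exact h γ le_rfl k

theorem continuous_phiSum (hβ : β ∉ OmegaSet q) {Z : ℂ} (hZ : ‖Z‖ < 1) :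
    Continuous fun γ => phiSum γ β q Z := by
  rw [continuous_iff_continuousAt]
  intro γ
  obtain ⟨C, hC, h⟩ := exists_norm_phiCoeff_le hq0 hq hβ (‖γ‖ + 1)
  have : ContinuousOn (fun γ => phiSum γ β q Z) (Metric.ball 0 (‖γ‖ + 1)) := by
    refine continuousOn_tsum (fun k => ?_)
      ((summable_geometric_of_lt_one (norm_nonneg Z) hZ).mul_left C) fun k x hx => ?_
    · have := (differentiable_qPoch q k).continuous.continuousOn (s := Metric.ball 0 (‖γ‖ + 1))
      exact (this.div_const _).mul continuousOn_const
    · rw [norm_mul, norm_pow]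
      gcongr
      exact h x (by simpa using (Metric.mem_ball.1 hx).le) k
  exact this.continuousAt (Metric.isOpen_ball.mem_nhds (by simp))

omit hq0 in
theorem phiCoeff_succ {σ : ℂ} (hσ : q * σ ∉ OmegaSet q) (k : ℕ) :
    phiCoeff γ (q * σ) q (k + 1) * ((1 - q ^ (k + 1)) * (1 - σ * q ^ (k + 1)))
      = phiCoeff γ (q * σ) q k * (1 - γ * q ^ k) := by
  have h1 := qPoch_self_ne_zero hq k
  have h2 := one_sub_pow_succ_ne_zero hq k
  have h3 := qPoch_ne_zero hσ k
  have h4 : 1 - σ * q ^ (k + 1) ≠ 0 := by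
    have := one_sub_mul_pow_ne_zero hσ k
    rwa [show q * σ * q ^ k = σ * q ^ (k + 1) by ring] at this
  rw [phiCoeff, phiCoeff, qPoch_succ γ, qPoch_self_succ, qPoch_succ (q * σ),
    show q * σ * q ^ k = σ * q ^ (k + 1) by ring, div_mul_eq_mul_div, div_mul_eq_mul_div,
    div_eq_div_iff (by positivity) (by positivity)]
  ring

theorem hasSum_phiSum (hβ : β ∉ OmegaSet q) {Z : ℂ} (hZ : ‖Z‖ < 1) :
    HasSum (fun k => phiCoeff γ β q k * Z ^ k) (phiSum γ β q Z) :=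
  (summable_phiCoeff hq0 hq hβ γ hZ).hasSum

/-- The coefficient recurrence written as a q-difference equation: Z ↦ qZ multiplies the k-th
coefficient by q^k. Writing β = qσ makes the left operator factor as (1 - E)(1 - σE). -/
theorem phiSum_functional {σ : ℂ} (hσ : q * σ ∉ OmegaSet q) {Z : ℂ} (hZ : ‖Z‖ < 1) :
    phiSum γ (q * σ) q Z - (1 + σ) * phiSum γ (q * σ) q (q * Z)
        + σ * phiSum γ (q * σ) q (q * (q * Z))
      = Z * (phiSum γ (q * σ) q Z - γ * phiSum γ (q * σ) q (q * Z)) := by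
  have hZ1 : ‖q * Z‖ < 1 := by
    rw [norm_mul]; exact mul_lt_one_of_nonneg_of_lt_one_left (norm_nonneg _) hq hZ.le
  have hZ2 : ‖q * (q * Z)‖ < 1 := by
    rw [norm_mul]; exact mul_lt_one_of_nonneg_of_lt_one_left (norm_nonneg _) hq hZ1.le
  have s0 := hasSum_phiSum (γ := γ) hq0 hq hσ hZ
  have s1 := hasSum_phiSum (γ := γ) hq0 hq hσ hZ1
  have s2 := hasSum_phiSum (γ := γ) hq0 hq hσ hZ2
  have l := (s0.sub (s1.mul_left (1 + σ))).add (s2.mul_left σ)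
  have r := (s0.sub (s1.mul_left γ)).mul_left Z
  refine l.unique ?_
  -- The constant terms on the left cancel, so it is reindexed from k = 1 and matched with the right
  -- side termwise.
  rw [hasSum_nat_add_iff' 1 |>.symm]
  have e0 : ∑ i ∈ Finset.range 1, (phiCoeff γ (q * σ) q i * Z ^ i
      - (1 + σ) * (phiCoeff γ (q * σ) q i * (q * Z) ^ i)
      + σ * (phiCoeff γ (q * σ) q i * (q * (q * Z)) ^ i)) = 0 := by
    simp; ring
  rw [e0, sub_zero]
  refine hasSum_of_eq r fun k => ?_
  have := phiCoeff_succ (γ := γ) hq hσ k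
  simp only [mul_pow] at *
  linear_combination Z ^ (k + 1) * this

omit hq0 in
theorem tendsto_phiCoeff (hq0 : q ≠ 0) (hβ : β ∉ OmegaSet q) :
    Tendsto (phiCoeff γ β q) atTop
      (𝓝 (qPochInf γ q / (qPochInf q q * qPochInf β q))) :=
  (tendsto_qPoch γ hq).div ((tendsto_qPoch q hq).mul (tendsto_qPoch β hq))
    (mul_ne_zero (qPochInf_ne_zero hq (not_mem_OmegaSet_of_norm_lt_one hq0 hq hq))
      (qPochInf_ne_zero hq hβ))

/-- The substitute for `phiSum_functional` at Z = 1, outside the disc used there. The coefficient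
recurrence telescopes, and the limit of the coefficients survives as a boundary term. -/
theorem phiSum_boundary {σ : ℂ} (hσ : q * σ ∉ OmegaSet q) :
    qPochInf γ q / (qPochInf q q * qPochInf (q * σ) q)
      = (1 + σ - γ) * phiSum γ (q * σ) q q - σ * phiSum γ (q * σ) q (q * q) := by
  have hq2 : ‖q * q‖ < 1 := by
    rw [norm_mul]; exact mul_lt_one_of_nonneg_of_lt_one_left (norm_nonneg _) hq hq.le
  have s1 := hasSum_phiSum (γ := γ) hq0 hq hσ hq
  have s2 := hasSum_phiSum (γ := γ) hq0 hq hσ hq2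
  have t1 := (hasSum_nat_add_iff' 1).2 s1
  have t2 := (hasSum_nat_add_iff' 1).2 s2
  have l := ((t1.mul_left (1 + σ)).sub (t2.mul_left σ)).sub (s1.mul_left γ)
  have r := ((tendsto_phiCoeff (γ := γ) hq hq0 hσ).sub_const (phiCoeff γ (q * σ) q 0))
  have := tendsto_nhds_unique l.tendsto_sum_nat (r.congr fun n => ?_)
  · simp [phiCoeff, qPoch_zero] at this
    simp only [phiCoeff] at *
    linear_combination -this
  · rw [← Finset.sum_range_sub]
    refine Finset.sum_congr rfl fun k _ => ?_
    have := phiCoeff_succ (γ := γ) hq hσ k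
    rw [mul_pow]
    linear_combination this

theorem phiSum_shift (hβ : β ∉ OmegaSet q) {Z : ℂ} (hZ : ‖Z‖ < 1) :
    (1 - γ) * phiSum (γ * q) β q Z = phiSum γ β q Z - γ * phiSum γ β q (q * Z) := by
  have hZ1 : ‖q * Z‖ < 1 := by
    rw [norm_mul]; exact mul_lt_one_of_nonneg_of_lt_one_left (norm_nonneg _) hq hZ.le
  have s0 := hasSum_phiSum (γ := γ) hq0 hq hβ hZ
  have s1 := hasSum_phiSum (γ := γ) hq0 hq hβ hZ1
  have s2 := hasSum_phiSum (γ := γ * q) hq0 hq hβ hZ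
  refine (s2.mul_left (1 - γ)).unique (hasSum_of_eq (s0.sub (s1.mul_left γ)) fun k => ?_)
  have := (qPoch_succ' γ q k).symm.trans (qPoch_succ γ q k)
  simp only [phiCoeff, mul_pow]
  linear_combination Z ^ k / (qPoch q q k * qPoch β q k) * this

end

/-! ### Moments of the two-sided q-integral. -/

/-- The moments of the two-sided `q`-integral in the transformation formula. -/
noncomputable def qMoment (q τ γ : ℂ) (m : ℕ) : ℂ :=
  qPochInf (γ * τ) q / qPochInf τ q * phiSum γ (q * τ⁻¹) q (q ^ (m + 1))
    + qPochInf γ q / qPochInf τ⁻¹ q * (τ ^ m * phiSum (γ * τ) (q * τ) q (q ^ (m + 1)))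

section
variable {q τ : ℂ} (hq0 : q ≠ 0) (hq : ‖q‖ < 1) (hτ : ∀ m : ℤ, τ ≠ q ^ m)

theorem inv_ne_zpow (hτ : ∀ m : ℤ, τ ≠ q ^ m) (m : ℤ) : τ⁻¹ ≠ q ^ m := fun h =>
  hτ (-m) (by rw [zpow_neg, ← h, inv_inv])

include hq0 in
theorem mul_ne_zpow (hτ : ∀ m : ℤ, τ ≠ q ^ m) (m : ℤ) : q * τ ≠ q ^ m := fun h =>
  hτ (m - 1) (by rw [zpow_sub_one₀ hq0, ← h]; field_simp)

include hq0 hq hτ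

/-- The q-difference equations with σ = τ⁻¹ and σ = τ give the same recurrence once the second
series is twisted by τ^m, so each summand satisfies it separately. -/
theorem qMoment_succ_succ (hτ0 : τ ≠ 0) (γ : ℂ) (m : ℕ) :
    qMoment q τ γ (m + 2) = (1 + τ - γ * τ * q ^ (m + 1)) * qMoment q τ γ (m + 1)
      - τ * (1 - q ^ (m + 1)) * qMoment q τ γ m := by
  have h1 : q * τ ∉ OmegaSet q := not_mem_OmegaSet_of_zpow (mul_ne_zpow hq0 hτ)
  have h2 : q * τ⁻¹ ∉ OmegaSet q :=
    not_mem_OmegaSet_of_zpow (mul_ne_zpow hq0 (inv_ne_zpow hτ))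
  have hZ : ‖q ^ (m + 1)‖ < 1 := by
    rw [norm_pow]; exact pow_lt_one₀ (norm_nonneg q) hq (by simp)
  have f1 := phiSum_functional (γ := γ * τ) hq0 hq h1 hZ
  have f2 := phiSum_functional (γ := γ) hq0 hq h2 hZ
  rw [← pow_succ' q (m + 1), ← pow_succ' q (m + 1 + 1)] at f1 f2
  simp only [qMoment]
  have f2' : phiSum γ (q * τ⁻¹) q (q ^ (m + 1 + 1 + 1))
      = (1 + τ - γ * τ * q ^ (m + 1)) * phiSum γ (q * τ⁻¹) q (q ^ (m + 1 + 1))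
      - τ * (1 - q ^ (m + 1)) * phiSum γ (q * τ⁻¹) q (q ^ (m + 1)) := by
    field_simp at f2 ⊢
    linear_combination f2
  rw [show m + 2 + 1 = m + 1 + 1 + 1 by ring, f2']
  linear_combination qPochInf γ q / qPochInf τ⁻¹ q * τ ^ (m + 1) * f1

theorem qMoment_one (hτ0 : τ ≠ 0) (γ : ℂ) :
    qMoment q τ γ 1 = (1 + τ - γ * τ) * qMoment q τ γ 0 := by
  have h1 : q * τ ∉ OmegaSet q := not_mem_OmegaSet_of_zpow (mul_ne_zpow hq0 hτ)
  have h2 : q * τ⁻¹ ∉ OmegaSet q :=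
    not_mem_OmegaSet_of_zpow (mul_ne_zpow hq0 (inv_ne_zpow hτ))
  have f1 := phiSum_boundary (γ := γ * τ) hq0 hq h1
  have f2 := phiSum_boundary (γ := γ) hq0 hq h2
  have n1 := qPochInf_ne_zero hq h1
  have n2 := qPochInf_ne_zero hq h2
  have n3 := qPochInf_ne_zero hq (not_mem_OmegaSet_of_norm_lt_one hq0 hq hq)
  have e1 := qPochInf_eq_one_sub_mul τ hq
  have e2 := qPochInf_eq_one_sub_mul τ⁻¹ hq
  have k1 : 1 - τ ≠ 0 := fun h => hτ 0 (by simpa using (sub_eq_zero.1 h).symm)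
  have k2 : 1 - τ⁻¹ ≠ 0 := fun h => inv_ne_zpow hτ 0 (by simpa using (sub_eq_zero.1 h).symm)
  have k3 : τ - 1 ≠ 0 := fun h => k1 (by linear_combination -h)
  simp only [qMoment, zero_add, pow_one, pow_zero, one_mul, e1, e2, mul_comm τ q,
    mul_comm τ⁻¹ q, show q ^ (1 + 1) = q * q by ring]
  have g1 : τ * phiSum (γ * τ) (q * τ) q (q * q)
      = (1 + τ - γ * τ) * phiSum (γ * τ) (q * τ) q q
        - qPochInf (γ * τ) q / (qPochInf q q * qPochInf (q * τ) q) := by rw [f1]; ring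
  have g2 : phiSum γ (q * τ⁻¹) q (q * q)
      = (1 + τ - γ * τ) * phiSum γ (q * τ⁻¹) q q
        - τ * (qPochInf γ q / (qPochInf q q * qPochInf (q * τ⁻¹) q)) := by
    rw [f2]; field_simp; ring
  -- The summands do not satisfy this relation separately: their boundary terms cancel against each
  -- other, because 1 - τ⁻¹ = -(1 - τ)/τ.
  rw [g1, g2, show 1 - τ⁻¹ = (τ - 1) / τ by field_simp]
  generalize phiSum γ (q * τ⁻¹) q q = X
  generalize phiSum (γ * τ) (q * τ) q q = Y
  generalize qPochInf (q * τ⁻¹) q = U at *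
  generalize qPochInf (q * τ) q = V at *
  field_simp
  rw [show τ - 1 = -(1 - τ) by ring]
  field_simp
  ring

theorem continuous_qMoment_zero : Continuous fun γ => qMoment q τ γ 0 := by
  have h1 : q * τ ∉ OmegaSet q := not_mem_OmegaSet_of_zpow (mul_ne_zpow hq0 hτ)
  have h2 : q * τ⁻¹ ∉ OmegaSet q :=
    not_mem_OmegaSet_of_zpow (mul_ne_zpow hq0 (inv_ne_zpow hτ))
  have c := (differentiable_qPochInf hq).continuous
  have p1 := continuous_phiSum hq0 hq h1 hq
  have p2 := continuous_phiSum hq0 hq h2 hq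
  simp only [qMoment, zero_add, pow_one, pow_zero, one_mul]
  have ht : Continuous fun γ : ℂ => γ * τ := by fun_prop
  exact (((c.comp ht).div_const _).mul p2).add ((c.div_const _).mul (p1.comp ht))

/-- Contiguity in γ yields M₀ - γM₁, and `qMoment_one` turns this into (1 - γ)(1 - γτ)M₀. -/
theorem qMoment_zero_shift (hτ0 : τ ≠ 0) {γ : ℂ} (h1 : 1 - γ ≠ 0) (h2 : 1 - γ * τ ≠ 0) :
    qMoment q τ (γ * q) 0 = qMoment q τ γ 0 := by
  have o1 : q * τ ∉ OmegaSet q := not_mem_OmegaSet_of_zpow (mul_ne_zpow hq0 hτ)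
  have o2 : q * τ⁻¹ ∉ OmegaSet q :=
    not_mem_OmegaSet_of_zpow (mul_ne_zpow hq0 (inv_ne_zpow hτ))
  have f1 := phiSum_shift (γ := γ * τ) hq0 hq o1 hq
  have f2 := phiSum_shift (γ := γ) hq0 hq o2 hq
  have m1 := qMoment_one hq0 hq hτ hτ0 γ
  refine mul_left_cancel₀ (mul_ne_zero h1 h2) ?_
  have key : (1 - γ) * (1 - γ * τ) * qMoment q τ (γ * q) 0
      = qMoment q τ γ 0 - γ * qMoment q τ γ 1 := by
    simp only [qMoment, zero_add, pow_one, pow_zero, one_mul, show q ^ (1 + 1) = q * q by ring,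
      show γ * q * τ = γ * τ * q by ring, qPochInf_eq_one_sub_mul γ hq,
      qPochInf_eq_one_sub_mul (γ * τ) hq]
    linear_combination (1 - γ * τ) * qPochInf (γ * τ * q) q / qPochInf τ q * f2
      + (1 - γ) * qPochInf (γ * q) q / qPochInf τ⁻¹ q * f1
  rw [key, m1]
  ring

/-- Iterating γ ↦ γq and letting γq^n → 0 shows independence of γ off a countable set, and density
with continuity removes the exception. At γ = 1 the second summand vanishes and the first series
reduces to its constant term. -/
theorem qMoment_zero (hτ0 : τ ≠ 0) (γ : ℂ) : qMoment q τ γ 0 = 1 := by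
  have hc := continuous_qMoment_zero hq0 hq hτ
  have hcount : (Set.range (fun n : ℕ => (q ^ n)⁻¹) ∪
      Set.range (fun n : ℕ => (τ * q ^ n)⁻¹)).Countable :=
    (Set.countable_range _).union (Set.countable_range _)
  have hd := hcount.dense_compl ℂ
  have hgen : Set.EqOn (fun γ => qMoment q τ γ 0) (fun _ => qMoment q τ 0 0)
      (Set.range (fun n : ℕ => (q ^ n)⁻¹) ∪ Set.range (fun n : ℕ => (τ * q ^ n)⁻¹))ᶜ := by
    intro γ hγ
    have hγ' : γ ∉ Set.range (fun n : ℕ => (q ^ n)⁻¹) ∧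
        γ ∉ Set.range (fun n : ℕ => (τ * q ^ n)⁻¹) := by simpa [not_or] using hγ
    have hstep : ∀ n : ℕ, qMoment q τ (γ * q ^ n) 0 = qMoment q τ γ 0 := by
      intro n
      induction n with
      | zero => simp
      | succ n ih =>
        rw [pow_succ, ← mul_assoc, qMoment_zero_shift hq0 hq hτ hτ0, ih]
        · exact one_sub_mul_pow_ne_zero hγ'.1 n
        · intro h
          refine hγ'.2 ⟨n, ?_⟩
          exact (eq_inv_of_mul_eq_one_left (by linear_combination -h)).symm
    have ht : Tendsto (fun n : ℕ => γ * q ^ n) atTop (𝓝 0) := by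
      simpa using (tendsto_pow_atTop_nhds_zero_of_norm_lt_one hq).const_mul γ
    have := (hc.tendsto 0).comp ht
    exact tendsto_nhds_unique (tendsto_const_nhds.congr fun n => (hstep n).symm) this
  have hall := hc.ext_on hd continuous_const hgen
  have h1 : qMoment q τ 1 0 = 1 := by
    have hτn := qPochInf_ne_zero hq (not_mem_OmegaSet_of_zpow hτ)
    have hφ : phiSum 1 (q * τ⁻¹) q q = 1 := by
      rw [phiSum, tsum_eq_single 0]
      · simp [phiCoeff, qPoch_zero]
      · intro k hk
        obtain ⟨k, rfl⟩ := Nat.exists_eq_succ_of_ne_zero hk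
        simp [phiCoeff, qPoch_succ']
    simp [qMoment, qPochInf_one_left hq, hφ, hτn]
  exact (congrFun hall γ).trans ((congrFun hall 1).symm.trans h1)

end

/-! ### Gaussian binomials and Rogers–Szegő type polynomials. -/

/-- The product `(1 - q^m)(1 - q^(m-1)) ⋯ (1 - q^(m-n+1)) / (q;q)_n`, a Gaussian binomial
coefficient. -/
noncomputable def gaussBinom (q : ℂ) (m n : ℕ) : ℂ :=
  (∏ j ∈ Finset.range n, (1 - q ^ m * (q ^ j)⁻¹)) / qPoch q q n

section
variable {q : ℂ} (hq0 : q ≠ 0) (hq : ‖q‖ < 1)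

theorem gaussBinom_zero_right (q : ℂ) (m : ℕ) : gaussBinom q m 0 = 1 := by
  simp [gaussBinom, qPoch_zero]

include hq0

theorem gaussBinom_eq_zero {m n : ℕ} (h : m < n) : gaussBinom q m n = 0 := by
  rw [gaussBinom, Finset.prod_eq_zero (Finset.mem_range.2 h), zero_div]
  rw [mul_inv_cancel₀ (pow_ne_zero _ hq0), sub_self]

theorem prod_one_sub_succ (m n : ℕ) :
    ∏ j ∈ Finset.range (n + 1), (1 - q ^ (m + 1) * (q ^ j)⁻¹)
      = (1 - q ^ (m + 1)) * ∏ j ∈ Finset.range n, (1 - q ^ m * (q ^ j)⁻¹) := by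
  rw [Finset.prod_range_succ', mul_comm]
  congr 1
  · simp
  · refine Finset.prod_congr rfl fun j _ => ?_
    rw [pow_succ, pow_succ]
    field_simp

theorem gaussBinom_mul (m n : ℕ) :
    (1 - q ^ (m + 1) * (q ^ n)⁻¹) * gaussBinom q (m + 1) n
      = (1 - q ^ (m + 1)) * gaussBinom q m n := by
  have := prod_one_sub_succ hq0 m n
  rw [Finset.prod_range_succ] at this
  rw [gaussBinom, gaussBinom]
  linear_combination this / qPoch q q n

include hq

theorem gaussBinom_succ_succ (m n : ℕ) :
    gaussBinom q (m + 1) (n + 1)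
      = gaussBinom q m (n + 1) + q ^ m * (q ^ n)⁻¹ * gaussBinom q m n := by
  have h1 := qPoch_self_ne_zero hq n
  have h2 := one_sub_pow_succ_ne_zero hq n
  have h3 : q ^ n ≠ 0 := pow_ne_zero _ hq0
  rw [gaussBinom, gaussBinom, gaussBinom, prod_one_sub_succ hq0, Finset.prod_range_succ,
    qPoch_self_succ]
  field_simp
  ring

/-- The Rogers–Szegő type polynomials `∑ (γ;q)_n [m, n] τ^n`. -/
noncomputable def rogersSzego (q τ γ : ℂ) (m : ℕ) : ℂ :=
  ∑ n ∈ Finset.range (m + 1), qPoch γ q n * τ ^ n * gaussBinom q m n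

omit hq in
theorem rogersSzego_eq_sum (τ γ : ℂ) {m N : ℕ} (h : m + 1 ≤ N) :
    rogersSzego q τ γ m = ∑ n ∈ Finset.range N, qPoch γ q n * τ ^ n * gaussBinom q m n := by
  refine Finset.sum_subset (by simpa using h) fun n _ hn => ?_
  rw [gaussBinom_eq_zero hq0 (by simpa using hn), mul_zero]

/-- Pascal's rule gives the increment `e1`. In it, q^(m+1-n) is written as 1 - (1 - q^(m+1-n)), and
the absorption identity `gaussBinom_mul` lowers m in the second part. -/
theorem rogersSzego_succ_succ (τ γ : ℂ) (m : ℕ) :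
    rogersSzego q τ γ (m + 2) = (1 + τ - γ * τ * q ^ (m + 1)) * rogersSzego q τ γ (m + 1)
      - τ * (1 - q ^ (m + 1)) * rogersSzego q τ γ m := by
  have e1 : rogersSzego q τ γ (m + 2) = rogersSzego q τ γ (m + 1)
      + ∑ n ∈ Finset.range (m + 2), τ * (1 - γ * q ^ n) * (q ^ (m + 1) * (q ^ n)⁻¹)
        * (qPoch γ q n * τ ^ n * gaussBinom q (m + 1) n) := by
    rw [rogersSzego, rogersSzego_eq_sum hq0 τ γ (m := m + 1) (N := m + 2 + 1) (by omega),
      Finset.sum_range_succ', Finset.sum_range_succ' _ (m + 2), gaussBinom_zero_right,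
      gaussBinom_zero_right, add_right_comm, ← Finset.sum_add_distrib]
    congr 1
    refine Finset.sum_congr rfl fun n _ => ?_
    rw [gaussBinom_succ_succ hq0 hq, qPoch_succ, pow_succ τ]
    ring
  rw [e1, rogersSzego, rogersSzego_eq_sum hq0 τ γ (m := m) (N := m + 2) (by omega),
    Finset.mul_sum, Finset.mul_sum, ← Finset.sum_add_distrib, ← Finset.sum_sub_distrib]
  refine Finset.sum_congr rfl fun n _ => ?_
  have h := gaussBinom_mul hq0 (q := q) m n
  have h3 : q ^ n ≠ 0 := pow_ne_zero _ hq0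
  have h4 : q ^ n * (q ^ n)⁻¹ = 1 := mul_inv_cancel₀ h3
  linear_combination -τ * (qPoch γ q n * τ ^ n) * h
    - τ * γ * q ^ (m + 1) * (qPoch γ q n * τ ^ n) * gaussBinom q (m + 1) n * h4

theorem qMoment_eq_rogersSzego {τ : ℂ} (hτ0 : τ ≠ 0) (hτ : ∀ m : ℤ, τ ≠ q ^ m) (γ : ℂ) (m : ℕ) :
    qMoment q τ γ m = rogersSzego q τ γ m := by
  induction m using Nat.twoStepInduction with
  | zero => simp [qMoment_zero hq0 hq hτ hτ0, rogersSzego, gaussBinom_zero_right, qPoch_zero]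
  | one =>
    have : (1 - q) ≠ 0 := by simpa using one_sub_pow_succ_ne_zero hq 0
    rw [qMoment_one hq0 hq hτ hτ0, qMoment_zero hq0 hq hτ hτ0]
    simp [rogersSzego, Finset.sum_range_succ, gaussBinom, qPoch, this]
    ring
  | more m h1 h2 =>
    rw [qMoment_succ_succ hq0 hq hτ hτ0, rogersSzego_succ_succ hq0 hq, h1, h2]

end

/-! ### From monomials to analytic functions. -/

theorem hasSum_swap {F : ℕ → ℕ → ℂ} {r c : ℕ → ℂ} {u v : ℕ → ℝ} (hu : Summable u)
    (hv : Summable v) (hu0 : ∀ n, 0 ≤ u n) (hv0 : ∀ n, 0 ≤ v n)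
    (hF : ∀ n m, ‖F n m‖ ≤ u n * v m)
    (hr : ∀ n, HasSum (F n) (r n)) (hc : ∀ m, HasSum (fun n => F n m) (c m)) :
    HasSum c (∑' n, r n) := by
  have hs : Summable fun p : ℕ × ℕ => F p.1 p.2 :=
    Summable.of_norm_bounded (hu.mul_of_nonneg hv hu0 hv0) fun p => hF p.1 p.2
  have h1 : HasSum r (∑' p : ℕ × ℕ, F p.1 p.2) := hs.hasSum.prod_fiberwise hr
  have h2 : HasSum (fun p : ℕ × ℕ => F p.2 p.1) (∑' p : ℕ × ℕ, F p.1 p.2) :=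
    (Equiv.prodComm ℕ ℕ).hasSum_iff.2 hs.hasSum
  rw [h1.tsum_eq]
  exact h2.prod_fiberwise hc

theorem exists_hasSum_mul_pow {G : ℂ → ℂ} {R ρ : ℝ} (hρ : 0 ≤ ρ) (hρR : ρ < R)
    (hG : DifferentiableOn ℂ G (Metric.ball 0 R)) :
    ∃ g : ℕ → ℂ, (∀ x ∈ Metric.ball (0 : ℂ) R, HasSum (fun m => g m * x ^ m) (G x)) ∧
      Summable fun m => ‖g m‖ * ρ ^ m := by
  have h : ∀ x ∈ Metric.ball (0 : ℂ) R, HasSum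
      (fun m : ℕ => (m.factorial : ℂ)⁻¹ * iteratedDeriv m G 0 * x ^ m) (G x) := by
    intro x hx
    refine hasSum_of_eq (Complex.hasSum_taylorSeries_on_ball hG hx) fun m => ?_
    simp only [smul_eq_mul, sub_zero]
    ring
  refine ⟨_, h, ?_⟩
  have hm : (ρ : ℂ) ∈ Metric.ball (0 : ℂ) R := by
    simpa [abs_of_nonneg hρ] using hρR
  simpa [norm_mul, norm_pow, abs_of_nonneg hρ] using (h _ hm).summable.norm

section
variable {q : ℂ} (hq0 : q ≠ 0) (hq : ‖q‖ < 1)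
include hq0 hq

theorem gaussBinom_add (n d : ℕ) :
    gaussBinom q (n + d) n = qPoch q q (n + d) * (qPoch q q d)⁻¹ * (qPoch q q n)⁻¹ := by
  have hd := qPoch_self_ne_zero hq d
  rw [gaussBinom, div_eq_mul_inv]
  congr 1
  induction n with
  | zero => simp [hd]
  | succ n ih =>
    rw [show n + 1 + d = n + d + 1 by ring, prod_one_sub_succ hq0, ih, qPoch_self_succ]
    ring

theorem exists_norm_gaussBinom_le : ∃ C : ℝ, 0 < C ∧ ∀ m n, ‖gaussBinom q m n‖ ≤ C := by
  obtain ⟨C, hC, h⟩ := exists_norm_inv_qPoch_le hq (not_mem_OmegaSet_of_norm_lt_one hq0 hq hq)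
  refine ⟨Real.exp (‖q‖ * (1 - ‖q‖)⁻¹) * C * C, by positivity, fun m n => ?_⟩
  rcases lt_or_ge m n with hmn | hmn
  · rw [gaussBinom_eq_zero hq0 hmn, norm_zero]; positivity
  · obtain ⟨d, rfl⟩ := Nat.exists_eq_add_of_le hmn
    rw [gaussBinom_add hq0 hq, norm_mul, norm_mul]
    gcongr
    · exact norm_qPoch_le hq le_rfl _
    · exact h d
    · exact h n

/-- Since q^k (wq^k)^m = w^m (q^(m+1))^k, exchanging the sums produces the argument q^(m+1) seen in
`qMoment`. -/
theorem hasSum_phiSum_mul {γ β w : ℂ} (hβ : β ∉ OmegaSet q) {G : ℂ → ℂ} {g : ℕ → ℂ} {ρ : ℝ}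
    (hw : ‖w‖ ≤ ρ) (hg : Summable fun m => ‖g m‖ * ρ ^ m)
    (hG : ∀ x : ℂ, ‖x‖ ≤ ρ → HasSum (fun m => g m * x ^ m) (G x)) :
    HasSum (fun m => g m * w ^ m * phiSum γ β q (q ^ (m + 1)))
      (∑' k, phiCoeff γ β q k * q ^ k * G (w * q ^ k)) := by
  obtain ⟨C, hC, h⟩ := exists_norm_phiCoeff_le hq0 hq hβ ‖γ‖
  have hρ : 0 ≤ ρ := (norm_nonneg w).trans hw
  have hqk : ∀ k : ℕ, ‖q ^ k‖ ≤ 1 := fun k => by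
    rw [norm_pow]; exact pow_le_one₀ (norm_nonneg q) hq.le
  have hwk : ∀ k : ℕ, ‖w * q ^ k‖ ≤ ρ := fun k => by
    rw [norm_mul]
    exact (mul_le_of_le_one_right (norm_nonneg w) (hqk k)).trans hw
  refine hasSum_swap
    (F := fun k m => phiCoeff γ β q k * q ^ k * (g m * (w * q ^ k) ^ m))
    (u := fun k => C * ‖q‖ ^ k) (v := fun m => ‖g m‖ * ρ ^ m)
    ((summable_geometric_of_lt_one (norm_nonneg q) hq).mul_left C) hg
    (fun k => by positivity) (fun m => by positivity) (fun k m => ?_)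
    (fun k => (hG _ (hwk k)).mul_left _) (fun m => ?_)
  · rw [norm_mul, norm_mul, norm_mul, norm_pow, norm_pow]
    gcongr
    · exact h γ le_rfl k
    · exact hwk k
  · have hZ : ‖q ^ (m + 1)‖ < 1 := by
      rw [norm_pow]; exact pow_lt_one₀ (norm_nonneg q) hq (by simp)
    refine hasSum_of_eq ((hasSum_phiSum hq0 hq hβ hZ).mul_left _) fun k => ?_
    rw [mul_pow, ← pow_mul, ← pow_mul, mul_comm k m, add_mul, pow_add, one_mul]
    ring

/-- The transformation for a function analytic on a disc of large radius: the series of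
`q`-differences at `a` equals a two-sided `q`-integral between `t` and `a`. -/
theorem tsum_qDiff_eq {a t γ : ℂ} (ha : a ≠ 0) (ht : t ≠ 0) (hta : ∀ m : ℤ, t / a ≠ q ^ m)
    {ρ : ℝ} (haρ : ‖a‖ ≤ ρ) (htρ : ‖t‖ ≤ ρ) {G : ℂ → ℂ}
    (hG : DifferentiableOn ℂ G (Metric.ball 0 (3 * ρ))) :
    ∑' n, qPoch γ q n * (t / a) ^ n * qDiff q n (fun k => G (a * q ^ k)) 0
      = qPochInf (γ * (t / a)) q / qPochInf (t / a) q
          * ∑' k, phiCoeff γ (q * (t / a)⁻¹) q k * q ^ k * G (a * q ^ k)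
        + qPochInf γ q / qPochInf (t / a)⁻¹ q
          * ∑' k, phiCoeff (γ * (t / a)) (q * (t / a)) q k * q ^ k * G (t * q ^ k) := by
  have hτ0 : t / a ≠ 0 := div_ne_zero ht ha
  have ha' : 0 < ‖a‖ := norm_pos_iff.2 ha
  have hρ : 0 < ρ := ha'.trans_le haρ
  -- Three radii: ρ bounds the evaluation points, 2ρ leaves room for geometric decay in n, and 3ρ
  -- ensures absolute convergence at 2ρ.
  obtain ⟨g, hgG, hgs⟩ := exists_hasSum_mul_pow (ρ := 2 * ρ) (by positivity) (by linarith) hG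
  have hgρ : Summable fun m => ‖g m‖ * ρ ^ m :=
    Summable.of_nonneg_of_le (fun m => by positivity)
      (fun m => by gcongr; linarith) hgs
  have hgG' : ∀ x : ℂ, ‖x‖ ≤ ρ → HasSum (fun m => g m * x ^ m) (G x) := fun x hx =>
    hgG x (by rw [Metric.mem_ball, dist_zero_right]; linarith)
  have hβ1 : q * (t / a)⁻¹ ∉ OmegaSet q :=
    not_mem_OmegaSet_of_zpow (mul_ne_zpow hq0 (inv_ne_zpow hta))
  have hβ2 : q * (t / a) ∉ OmegaSet q := not_mem_OmegaSet_of_zpow (mul_ne_zpow hq0 hta)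
  have r1 := hasSum_phiSum_mul (γ := γ) hq0 hq hβ1 haρ hgρ hgG'
  have r2 := hasSum_phiSum_mul (γ := γ * (t / a)) hq0 hq hβ2 htρ hgρ hgG'
  have r := (r1.mul_left (qPochInf (γ * (t / a)) q / qPochInf (t / a) q)).add
    (r2.mul_left (qPochInf γ q / qPochInf (t / a)⁻¹ q))
  refine HasSum.unique (f := fun m => g m * a ^ m * rogersSzego q (t / a) γ m) ?_
    (hasSum_of_eq r fun m => ?_)
  · obtain ⟨C, hC, h⟩ := exists_norm_gaussBinom_le hq0 hq
    -- With m = n + d, |t^n a^d| ≤ ρ^m ≤ 2^(-n) (2ρ)^m, which gives a majorant of product form.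
    refine hasSum_swap
      (F := fun n m => qPoch γ q n * (t / a) ^ n * (g m * a ^ m * gaussBinom q m n))
      (u := fun n => Real.exp (‖γ‖ * (1 - ‖q‖)⁻¹) * C * (1 / 2) ^ n)
      (v := fun m => ‖g m‖ * (2 * ρ) ^ m)
      (summable_geometric_two.mul_left _) hgs (fun n => by positivity) (fun m => by positivity)
      (fun n m => ?_) (fun n => ?_) (fun m => ?_)
    · rcases lt_or_ge m n with hmn | hmn
      · rw [gaussBinom_eq_zero hq0 hmn, mul_zero, mul_zero, norm_zero]; positivity
      · obtain ⟨d, rfl⟩ := Nat.exists_eq_add_of_le hmn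
        have e : qPoch γ q n * (t / a) ^ n * (g (n + d) * a ^ (n + d) * gaussBinom q (n + d) n)
            = qPoch γ q n * gaussBinom q (n + d) n * (t ^ n * a ^ d) * g (n + d) := by
          rw [pow_add, div_pow]; field_simp
        rw [e]
        simp only [norm_mul, norm_pow]
        calc _ ≤ Real.exp (‖γ‖ * (1 - ‖q‖)⁻¹) * C * (ρ ^ n * ρ ^ d) * ‖g (n + d)‖ := by
              gcongr
              · exact norm_qPoch_le hq le_rfl n
              · exact h _ _
          _ ≤ Real.exp (‖γ‖ * (1 - ‖q‖)⁻¹) * C * (ρ ^ n * (2 * ρ) ^ d) * ‖g (n + d)‖ := by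
              gcongr; linarith
          _ = _ := by
              rw [pow_add, mul_pow 2 ρ n, one_div, inv_pow]; field_simp
    · refine HasSum.mul_left _ ?_
      have := hasSum_qDiff q (f := fun m k => g m * a ^ m * q ^ (m * k))
        (u := fun k => G (a * q ^ k)) (fun k => hasSum_of_eq (hgG' (a * q ^ k) ?_) fun m => ?_) n 0
      · refine hasSum_of_eq this fun m => ?_
        rw [qDiff_const_mul, qDiff_pow, gaussBinom]
        simp
      · rw [norm_mul, norm_pow]
        exact (mul_le_of_le_one_right ha'.le (pow_le_one₀ (norm_nonneg q) hq.le)).trans haρ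
      · rw [mul_pow, ← pow_mul, mul_comm k m, mul_assoc]
    · rw [rogersSzego, Finset.mul_sum]
      have : ∀ n ∉ Finset.range (m + 1),
          qPoch γ q n * (t / a) ^ n * (g m * a ^ m * gaussBinom q m n) = 0 := fun n hn => by
        rw [gaussBinom_eq_zero hq0 (by simpa using hn), mul_zero, mul_zero]
      convert hasSum_sum_of_ne_finset_zero (L := .unconditional ℕ) this using 1
      exact Finset.sum_congr rfl fun n _ => by ring
  · rw [← qMoment_eq_rogersSzego hq0 hq hτ0 hta, qMoment, div_pow]
    field_simp

/-- The transformation for small `z₁`, `z₂`. -/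
theorem tsum_qDiff_qPoch_of_small {a t b c γ z₁ z₂ : ℂ} (ha : a ≠ 0) (ht : t ≠ 0)
    (hta : ∀ m : ℤ, t / a ≠ q ^ m) (hab : a * b ∉ OmegaSet q) (hac : a * c ∉ OmegaSet q)
    (htb : t * b ∉ OmegaSet q) (htc : t * c ∉ OmegaSet q)
    {ρ : ℝ} (haρ : ‖a‖ ≤ ρ) (htρ : ‖t‖ ≤ ρ) (hz₁ : 3 * ρ * ‖z₁‖ < 1) (hz₂ : 3 * ρ * ‖z₂‖ < 1) :
    ∑' n, qPoch γ q n * (t / a) ^ n * qDiff q n (fun k =>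
        qPoch (a * z₁) q k / qPoch (a * b) q k * (qPoch (a * z₂) q k / qPoch (a * c) q k)) 0
      = qPochInf (γ * (t / a)) q / qPochInf (t / a) q
          * ∑' k, phiCoeff γ (q * (t / a)⁻¹) q k * q ^ k *
            (qPoch (a * z₁) q k / qPoch (a * b) q k * (qPoch (a * z₂) q k / qPoch (a * c) q k))
        + qPochInf γ q / qPochInf (t / a)⁻¹ q
          * (qPochInf (a * z₁) q * qPochInf (a * z₂) q * qPochInf (t * b) q * qPochInf (t * c) q
            / (qPochInf (a * b) q * qPochInf (a * c) q * qPochInf (t * z₁) q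
              * qPochInf (t * z₂) q))
          * ∑' k, phiCoeff (γ * (t / a)) (q * (t / a)) q k * q ^ k *
            (qPoch (t * z₁) q k / qPoch (t * b) q k
              * (qPoch (t * z₂) q k / qPoch (t * c) q k)) := by
  have hρ : 0 < ρ := (norm_pos_iff.2 ha).trans_le haρ
  -- Chosen so that G(wq^k)/G(w) is the required quotient of finite factorials. Smallness of z₁, z₂
  -- keeps its poles outside the disc of radius 3ρ.
  set G : ℂ → ℂ := fun x => qPochInf (x * b) q * qPochInf (x * c) q
    / (qPochInf (x * z₁) q * qPochInf (x * z₂) q) with hGdef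
  have hΩ : ∀ {x z : ℂ}, ‖x‖ ≤ 3 * ρ → 3 * ρ * ‖z‖ < 1 → x * z ∉ OmegaSet q := fun {x z} hx hz =>
    not_mem_OmegaSet_of_norm_lt_one hq0 hq (by
      rw [norm_mul]; exact (by gcongr : ‖x‖ * ‖z‖ ≤ 3 * ρ * ‖z‖).trans_lt hz)
  have hd := differentiable_qPochInf hq
  have hdm : ∀ z : ℂ, Differentiable ℂ fun x => qPochInf (x * z) q := fun z =>
    hd.comp (f := fun x : ℂ => x * z) (by fun_prop)
  have hG : DifferentiableOn ℂ G (Metric.ball 0 (3 * ρ)) := by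
    refine (((hdm b).mul (hdm c)).differentiableOn).div
      ((hdm z₁).mul (hdm z₂)).differentiableOn fun x hx => ?_
    have hx' : ‖x‖ ≤ 3 * ρ := by simpa using (Metric.mem_ball.1 hx).le
    exact mul_ne_zero (qPochInf_ne_zero hq (hΩ hx' hz₁)) (qPochInf_ne_zero hq (hΩ hx' hz₂))
  have hGk : ∀ w : ℂ, ‖w‖ ≤ ρ → w * b ∉ OmegaSet q → w * c ∉ OmegaSet q → ∀ k,
      G (w * q ^ k) = G w * (qPoch (w * z₁) q k / qPoch (w * b) q k
        * (qPoch (w * z₂) q k / qPoch (w * c) q k)) := by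
    intro w hw hb hc k
    have hw' : ‖w‖ ≤ 3 * ρ := by linarith
    have n1 := qPochInf_ne_zero hq (hΩ hw' hz₁)
    have n2 := qPochInf_ne_zero hq (hΩ hw' hz₂)
    simp only [hGdef, mul_right_comm w (q ^ k)]
    rw [← qPoch_mul_qPochInf (w * z₁) hq k] at n1 ⊢
    rw [← qPoch_mul_qPochInf (w * z₂) hq k] at n2 ⊢
    rw [← qPoch_mul_qPochInf (w * b) hq k, ← qPoch_mul_qPochInf (w * c) hq k]
    have m1 := left_ne_zero_of_mul n1
    have m2 := right_ne_zero_of_mul n1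
    have m3 := left_ne_zero_of_mul n2
    have m4 := right_ne_zero_of_mul n2
    have m5 := qPoch_ne_zero hb k
    have m6 := qPoch_ne_zero hc k
    field_simp
  have ha3 : ‖a‖ ≤ 3 * ρ := by linarith
  have ht3 : ‖t‖ ≤ 3 * ρ := by linarith
  have a1 := qPochInf_ne_zero hq (hΩ ha3 hz₁)
  have a2 := qPochInf_ne_zero hq (hΩ ha3 hz₂)
  have a3 := qPochInf_ne_zero hq hab
  have a4 := qPochInf_ne_zero hq hac
  have t1 := qPochInf_ne_zero hq (hΩ ht3 hz₁)
  have t2 := qPochInf_ne_zero hq (hΩ ht3 hz₂)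
  have hGa : G a ≠ 0 := div_ne_zero (mul_ne_zero a3 a4) (mul_ne_zero a1 a2)
  have main := tsum_qDiff_eq (γ := γ) hq0 hq ha ht hta haρ htρ hG
  simp only [hGk a haρ hab hac, hGk t htρ htb htc, qDiff_const_mul, mul_left_comm _ (G a),
    mul_left_comm _ (G t), tsum_mul_left] at main
  refine mul_left_cancel₀ hGa (main.trans ?_)
  have hGt : G t = G a * (qPochInf (a * z₁) q * qPochInf (a * z₂) q * qPochInf (t * b) q
      * qPochInf (t * c) q / (qPochInf (a * b) q * qPochInf (a * c) q * qPochInf (t * z₁) q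
        * qPochInf (t * z₂) q)) := by
    simp only [hGdef]
    generalize qPochInf (a * z₁) q = A₁ at *
    generalize qPochInf (a * z₂) q = A₂ at *
    generalize qPochInf (a * b) q = A₃ at *
    generalize qPochInf (a * c) q = A₄ at *
    field_simp
  rw [hGt]
  ring

end

/-! ### Analytic continuation to unit modulus. -/

section
variable {q : ℂ} (hq0 : q ≠ 0) (hq : ‖q‖ < 1)
include hq0 hq

theorem exists_norm_phiCoeff_mul_le {β y₁ y₂ : ℂ} (hβ : β ∉ OmegaSet q) (hy₁ : y₁ ∉ OmegaSet q)
    (hy₂ : y₂ ∉ OmegaSet q) (γ : ℂ) (R : ℝ) :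
    ∃ C : ℝ, 0 < C ∧ ∀ x₁ x₂ : ℂ, ‖x₁‖ ≤ R → ‖x₂‖ ≤ R → ∀ k : ℕ,
      ‖phiCoeff γ β q k * q ^ k * (qPoch x₁ q k / qPoch y₁ q k * (qPoch x₂ q k / qPoch y₂ q k))‖
        ≤ C * ‖q‖ ^ k := by
  obtain ⟨C₀, hC₀, h₀⟩ := exists_norm_phiCoeff_le hq0 hq hβ ‖γ‖
  obtain ⟨C₁, hC₁, h₁⟩ := exists_norm_inv_qPoch_le hq hy₁
  obtain ⟨C₂, hC₂, h₂⟩ := exists_norm_inv_qPoch_le hq hy₂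
  set E := Real.exp (R * (1 - ‖q‖)⁻¹)
  refine ⟨C₀ * (E * C₁ * (E * C₂)), by positivity, fun x₁ x₂ hx₁ hx₂ k => ?_⟩
  simp only [div_eq_mul_inv, norm_mul, norm_pow]
  calc _ ≤ C₀ * ‖q‖ ^ k * (E * C₁ * (E * C₂)) := by
        gcongr
        · exact h₀ γ le_rfl k
        · exact norm_qPoch_le hq hx₁ k
        · exact h₁ k
        · exact norm_qPoch_le hq hx₂ k
        · exact h₂ k
    _ = _ := by ring

theorem summable_phiCoeff_mul {β y₁ y₂ : ℂ} (hβ : β ∉ OmegaSet q) (hy₁ : y₁ ∉ OmegaSet q)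
    (hy₂ : y₂ ∉ OmegaSet q) (γ x₁ x₂ : ℂ) :
    Summable fun k => phiCoeff γ β q k * q ^ k
      * (qPoch x₁ q k / qPoch y₁ q k * (qPoch x₂ q k / qPoch y₂ q k)) := by
  obtain ⟨C, -, h⟩ := exists_norm_phiCoeff_mul_le hq0 hq hβ hy₁ hy₂ γ (max ‖x₁‖ ‖x₂‖)
  exact Summable.of_norm_bounded
    ((summable_geometric_of_lt_one (norm_nonneg q) hq).mul_left C)
    (h x₁ x₂ (le_max_left _ _) (le_max_right _ _))

omit hq0 hq in
theorem norm_mul_mul_le {w z s : ℂ} {r : ℝ} (hz : ‖z‖ ≤ 1) (hs : s ∈ Metric.ball (0 : ℂ) r) :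
    ‖w * (s * z)‖ ≤ ‖w‖ * r := by
  have : ‖s‖ ≤ r := by simpa using (Metric.mem_ball.1 hs).le
  rw [norm_mul, norm_mul]
  gcongr
  exact (mul_le_of_le_one_right (norm_nonneg s) hz).trans this

theorem differentiableOn_tsum_phiCoeff {β y₁ y₂ : ℂ} (hβ : β ∉ OmegaSet q)
    (hy₁ : y₁ ∉ OmegaSet q) (hy₂ : y₂ ∉ OmegaSet q) (γ w : ℂ) {z₁ z₂ : ℂ}
    (hz₁ : ‖z₁‖ ≤ 1) (hz₂ : ‖z₂‖ ≤ 1) (r : ℝ) :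
    DifferentiableOn ℂ (fun s => ∑' k, phiCoeff γ β q k * q ^ k
      * (qPoch (w * (s * z₁)) q k / qPoch y₁ q k * (qPoch (w * (s * z₂)) q k / qPoch y₂ q k)))
      (Metric.ball 0 r) := by
  obtain ⟨C, -, h⟩ := exists_norm_phiCoeff_mul_le hq0 hq hβ hy₁ hy₂ γ (‖w‖ * r)
  refine Complex.differentiableOn_tsum_of_summable_norm
    ((summable_geometric_of_lt_one (norm_nonneg q) hq).mul_left C) (fun k => ?_)
    Metric.isOpen_ball fun k s hs => h _ _ (norm_mul_mul_le hz₁ hs)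
      (norm_mul_mul_le hz₂ hs) k
  have hd : ∀ z : ℂ, Differentiable ℂ fun s => qPoch (w * (s * z)) q k := fun z =>
    (differentiable_qPoch q k).comp (f := fun s : ℂ => w * (s * z)) (by fun_prop)
  exact (((hd z₁).div_const _).mul ((hd z₂).div_const _)).const_mul _ |>.differentiableOn

/-- The factor |t/a|^n turns the bound (n + 1)(|a|r)^n into (n + 1)(|t|r)^n, so a cancels and only
|t|r < 1 is needed. -/
theorem exists_norm_qDiff_term_le {a t y₁ y₂ : ℂ} (ha : a ≠ 0) (hy₁ : y₁ ∉ OmegaSet q)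
    (hy₂ : y₂ ∉ OmegaSet q) (γ : ℂ) {r : ℝ} (hr : 0 < r) (htr : ‖t‖ * r < 1) :
    ∃ u : ℕ → ℝ, Summable u ∧ ∀ x₁ x₂ : ℂ, ‖x₁‖ ≤ ‖a‖ * r → ‖x₂‖ ≤ ‖a‖ * r → ∀ n : ℕ,
      ‖qPoch γ q n * (t / a) ^ n * qDiff q n (fun k =>
        qPoch x₁ q k / qPoch y₁ q k * (qPoch x₂ q k / qPoch y₂ q k)) 0‖ ≤ u n := by
  have ha' : 0 < ‖a‖ := norm_pos_iff.2 ha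
  obtain ⟨C, hC, h⟩ := exists_norm_qDiff_le hq0 hq hy₁ hy₂ (ρ := ‖a‖ * r) (by positivity)
  set E := Real.exp (‖γ‖ * (1 - ‖q‖)⁻¹)
  have h0 : 0 ≤ ‖t‖ * r := by positivity
  refine ⟨fun n => E * C * ((n : ℝ) ^ 1 * (‖t‖ * r) ^ n + (‖t‖ * r) ^ n), ?_,
    fun x₁ x₂ hx₁ hx₂ n => ?_⟩
  · refine ((summable_pow_mul_geometric_of_norm_lt_one 1 ?_).add
      (summable_geometric_of_lt_one h0 htr)).mul_left _
    rwa [Real.norm_of_nonneg h0]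
  · rw [norm_mul, norm_mul, norm_pow, norm_div]
    calc _ ≤ E * (‖t‖ / ‖a‖) ^ n * (C * ((n + 1) * (‖a‖ * r) ^ n)) := by
          gcongr
          · exact norm_qPoch_le hq le_rfl n
          · exact h x₁ x₂ hx₁ hx₂ n
      _ = _ := by
          dsimp only
          rw [div_pow, mul_pow, mul_pow]
          field_simp

/-- The transformation for `|z₁|, |z₂| ≤ 1`, by analytic continuation along `(s z₁, s z₂)`. -/
theorem tsum_qDiff_qPoch {a t b c γ z₁ z₂ : ℂ} (ha : a ≠ 0) (ht : t ≠ 0) (ht1 : ‖t‖ < 1)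
    (hta : ∀ m : ℤ, t / a ≠ q ^ m) (hab : a * b ∉ OmegaSet q) (hac : a * c ∉ OmegaSet q)
    (htb : t * b ∉ OmegaSet q) (htc : t * c ∉ OmegaSet q)
    (hz₁ : ‖z₁‖ ≤ 1) (hz₂ : ‖z₂‖ ≤ 1) :
    HasSum (fun n => qPoch γ q n * (t / a) ^ n * qDiff q n (fun k =>
        qPoch (a * z₁) q k / qPoch (a * b) q k * (qPoch (a * z₂) q k / qPoch (a * c) q k)) 0)
      (qPochInf (γ * (t / a)) q / qPochInf (t / a) q
          * ∑' k, phiCoeff γ (q * (t / a)⁻¹) q k * q ^ k *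
            (qPoch (a * z₁) q k / qPoch (a * b) q k * (qPoch (a * z₂) q k / qPoch (a * c) q k))
        + qPochInf γ q / qPochInf (t / a)⁻¹ q
          * (qPochInf (a * z₁) q * qPochInf (a * z₂) q * qPochInf (t * b) q * qPochInf (t * c) q
            / (qPochInf (a * b) q * qPochInf (a * c) q * qPochInf (t * z₁) q
              * qPochInf (t * z₂) q))
          * ∑' k, phiCoeff (γ * (t / a)) (q * (t / a)) q k * q ^ k *
            (qPoch (t * z₁) q k / qPoch (t * b) q k
              * (qPoch (t * z₂) q k / qPoch (t * c) q k))) := by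
  have ht' : 0 < ‖t‖ := norm_pos_iff.2 ht
  -- 1 < r puts s = 1 inside the disc; r < 1/|t| gives both the convergent majorant and nonvanishing
  -- denominators (tsz;q)_∞.
  obtain ⟨r, hr1, hr⟩ := exists_between ((one_lt_inv₀ ht').2 ht1)
  have hr0 : 0 < r := one_pos.trans hr1
  have htr : ‖t‖ * r < 1 := by
    rw [lt_inv_comm₀ hr0 ht', ← one_div, lt_div_iff₀ hr0] at hr; exact hr
  have hβ1 : q * (t / a)⁻¹ ∉ OmegaSet q :=
    not_mem_OmegaSet_of_zpow (mul_ne_zpow hq0 (inv_ne_zpow hta))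
  have hβ2 : q * (t / a) ∉ OmegaSet q := not_mem_OmegaSet_of_zpow (mul_ne_zpow hq0 hta)
  obtain ⟨u, hu, hub⟩ := exists_norm_qDiff_term_le hq0 hq ha hab hac γ hr0 htr
  set L : ℂ → ℕ → ℂ := fun s n => qPoch γ q n * (t / a) ^ n * qDiff q n (fun k =>
        qPoch (a * (s * z₁)) q k / qPoch (a * b) q k
          * (qPoch (a * (s * z₂)) q k / qPoch (a * c) q k)) 0 with hLdef
  have hLb : ∀ n, ∀ s ∈ Metric.ball (0 : ℂ) r, ‖L s n‖ ≤ u n := fun n s hs =>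
    hub _ _ (norm_mul_mul_le hz₁ hs) (norm_mul_mul_le hz₂ hs) n
  have hdk : ∀ (k : ℕ) (w z : ℂ), Differentiable ℂ fun s => qPoch (w * (s * z)) q k :=
    fun k w z =>
      (differentiable_qPoch q k).comp (f := fun s : ℂ => w * (s * z)) (by fun_prop)
  have hdi : ∀ (w z : ℂ), Differentiable ℂ fun s => qPochInf (w * (s * z)) q :=
    fun w z =>
      (differentiable_qPochInf hq).comp (f := fun s : ℂ => w * (s * z)) (by fun_prop)
  have hLd : DifferentiableOn ℂ (fun s => ∑' n, L s n) (Metric.ball 0 r) := by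
    refine Complex.differentiableOn_tsum_of_summable_norm hu (fun n => ?_) Metric.isOpen_ball hLb
    refine Differentiable.differentiableOn ?_
    simp only [hLdef, qDiff_eq_sum hq0 hq]
    refine Differentiable.const_mul (Differentiable.fun_sum fun k _ => ?_) _
    exact (Differentiable.const_mul
      (((hdk _ a z₁).div_const _).mul ((hdk _ a z₂).div_const _)) _).div_const _
  have hne : ∀ z : ℂ, ‖z‖ ≤ 1 → ∀ s ∈ Metric.ball (0 : ℂ) r, qPochInf (t * (s * z)) q ≠ 0 :=
    fun z hz s hs => qPochInf_ne_zero hq (not_mem_OmegaSet_of_norm_lt_one hq0 hq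
      ((norm_mul_mul_le hz hs).trans_lt htr))
  have a3 := qPochInf_ne_zero hq hab
  have a4 := qPochInf_ne_zero hq hac
  set Rs : ℂ → ℂ := fun s => qPochInf (γ * (t / a)) q / qPochInf (t / a) q
          * ∑' k, phiCoeff γ (q * (t / a)⁻¹) q k * q ^ k *
            (qPoch (a * (s * z₁)) q k / qPoch (a * b) q k
              * (qPoch (a * (s * z₂)) q k / qPoch (a * c) q k))
        + qPochInf γ q / qPochInf (t / a)⁻¹ q
          * (qPochInf (a * (s * z₁)) q * qPochInf (a * (s * z₂)) q * qPochInf (t * b) q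
              * qPochInf (t * c) q
            / (qPochInf (a * b) q * qPochInf (a * c) q * qPochInf (t * (s * z₁)) q
              * qPochInf (t * (s * z₂)) q))
          * ∑' k, phiCoeff (γ * (t / a)) (q * (t / a)) q k * q ^ k *
            (qPoch (t * (s * z₁)) q k / qPoch (t * b) q k
              * (qPoch (t * (s * z₂)) q k / qPoch (t * c) q k)) with hRdef
  have hRd : DifferentiableOn ℂ Rs (Metric.ball 0 r) := by
    have s1 := differentiableOn_tsum_phiCoeff hq0 hq hβ1 hab hac γ a hz₁ hz₂ r
    have s2 := differentiableOn_tsum_phiCoeff hq0 hq hβ2 htb htc (γ * (t / a)) t hz₁ hz₂ r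
    refine (s1.const_mul _).add (DifferentiableOn.mul (DifferentiableOn.const_mul ?_ _) s2)
    refine DifferentiableOn.div ?_ ?_ fun s hs =>
      mul_ne_zero (mul_ne_zero (mul_ne_zero a3 a4) (hne z₁ hz₁ s hs)) (hne z₂ hz₂ s hs)
    · exact ((((hdi a z₁).mul (hdi a z₂)).mul_const _).mul_const _).differentiableOn
    · exact (((hdi t z₁).const_mul _).mul (hdi t z₂)).differentiableOn
  have hev : (fun s => ∑' n, L s n) =ᶠ[𝓝 0] Rs := by
    set ρ := max ‖a‖ ‖t‖
    have hc : ∀ z : ℂ, ∀ᶠ s in 𝓝 (0 : ℂ), 3 * ρ * ‖s * z‖ < 1 := fun z => by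
      have : Continuous fun s : ℂ => 3 * ρ * ‖s * z‖ := by fun_prop
      exact (this.tendsto 0).eventually_lt_const (by simp)
    filter_upwards [hc z₁, hc z₂] with s h1 h2
    exact tsum_qDiff_qPoch_of_small hq0 hq ha ht hta hab hac htb htc (le_max_left _ _)
      (le_max_right _ _) h1 h2
  have heq := (hLd.analyticOnNhd Metric.isOpen_ball).eqOn_of_preconnected_of_eventuallyEq
    (hRd.analyticOnNhd Metric.isOpen_ball) (convex_ball 0 r).isPreconnected
    (Metric.mem_ball_self hr0) hev
  have h1 : (1 : ℂ) ∈ Metric.ball (0 : ℂ) r := by simpa using hr1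
  have hs : HasSum (L 1) (Rs 1) := by
    rw [← heq h1]
    exact (Summable.of_norm_bounded hu fun n => hLb n 1 h1).hasSum
  simpa only [hLdef, hRdef, one_mul] using hs

/-! ### Translation to the hypergeometric statement. -/

omit hq0 hq in
theorem qHypTerm_eq_phiCoeff (γ β x₁ x₂ y₁ y₂ q : ℂ) :
    qHypTerm [γ, x₁, x₂, 0] [y₁, y₂, β] q q = fun k => phiCoeff γ β q k * q ^ k
      * (qPoch x₁ q k / qPoch y₁ q k * (qPoch x₂ q k / qPoch y₂ q k)) := by
  funext k
  simp only [qHypTerm, qPochs, phiCoeff, List.map_cons, List.map_nil, List.prod_cons,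
    List.prod_nil, List.length_cons, List.length_nil, qPoch_zero_left]
  norm_num
  ring

/-- The factor (q^(-n);q)_k stops the series at k = n, leaving the sum in `qDiff_eq_sum`; the extra
(q;q)_n undoes the normalisation of `qDiff`. -/
theorem contDualQHahnTheta_eq_qDiff (a b c : ℂ) (n : ℕ) (θ : ℝ) :
    contDualQHahnTheta n θ a b c q
      = (a ^ n)⁻¹ * (qPoch (a * b) q n * qPoch (a * c) q n * qPoch q q n) *
        qDiff q n (fun k =>
          qPoch (a * Complex.exp (Complex.I * θ)) q k / qPoch (a * b) q k
          * (qPoch (a * Complex.exp (-(Complex.I * θ))) q k / qPoch (a * c) q k)) 0 := by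
  have hn := qPoch_self_ne_zero hq n
  have hvan : ∀ k ∉ Finset.range (n + 1), qPoch (q ^ n)⁻¹ q k = 0 := fun k hk => by
    refine Finset.prod_eq_zero (i := n) (by simpa [Nat.succ_le_iff] using hk) ?_
    rw [inv_mul_cancel₀ (pow_ne_zero _ hq0), sub_self]
  rw [contDualQHahnTheta, qHyp, tsum_eq_sum (s := Finset.range (n + 1)), qDiff_eq_sum hq0 hq]
  · simp only [qPochs, List.map_cons, List.map_nil, List.prod_cons, List.prod_nil, mul_one,
      ← mul_assoc]
    rw [mul_assoc _ (qPoch q q n), Finset.mul_sum (a := qPoch q q n)]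
    congr 1
    refine Finset.sum_congr rfl fun k _ => ?_
    simp only [qHypTerm, qPochs, List.map_cons, List.map_nil, List.prod_cons,
      List.prod_nil, List.length_cons, List.length_nil, zero_add]
    norm_num
    field_simp
  · intro k hk
    simp [qHypTerm, qPochs, hvan k hk]

end

theorem mainTheorem11 (q γ t a b c : ℂ) (θ : ℝ)
    (hq0 : q ≠ 0) (hq1 : ‖q‖ < 1)
    (ht0 : t ≠ 0) (ht1 : ‖t‖ < 1)
    (ha : a ≠ 0) (hb : b ≠ 0) (hc : c ≠ 0)
    (hab : a * b ∉ OmegaSet q) (hac : a * c ∉ OmegaSet q)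
    (htb : t * b ∉ OmegaSet q) (htc : t * c ∉ OmegaSet q)
    (hta : ∀ m : ℤ, t / a ≠ q ^ m) :
    Summable (qHypTerm [γ, a * Complex.exp (Complex.I * θ),
          a * Complex.exp (-(Complex.I * θ)), 0] [a * b, a * c, q * a / t] q q) ∧
    Summable (qHypTerm [γ * t / a, t * Complex.exp (Complex.I * θ),
          t * Complex.exp (-(Complex.I * θ)), 0] [t * b, t * c, q * t / a] q q) ∧
    HasSum
      (fun n : ℕ => qPoch γ q n * contDualQHahn n (Real.cos θ) a b c q
        / qPochs [q, a * b, a * c] q n * t ^ n)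
      (qPochInf (γ * t / a) q / qPochInf (t / a) q
          * qHyp [γ, a * Complex.exp (Complex.I * θ),
          a * Complex.exp (-(Complex.I * θ)), 0] [a * b, a * c, q * a / t] q q
        + qPochInfs [a * Complex.exp (Complex.I * θ),
          a * Complex.exp (-(Complex.I * θ)), t * b, t * c, γ] q
            / qPochInfs [a * b, a * c, t * Complex.exp (Complex.I * θ),
          t * Complex.exp (-(Complex.I * θ)), a / t] q
          * qHyp [γ * t / a, t * Complex.exp (Complex.I * θ),
          t * Complex.exp (-(Complex.I * θ)), 0] [t * b, t * c, q * t / a] q q) := by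
  have e1 : q * a / t = q * (t / a)⁻¹ := by rw [inv_div, mul_div_assoc]
  have e2 : q * t / a = q * (t / a) := mul_div_assoc _ _ _
  have e3 : γ * t / a = γ * (t / a) := mul_div_assoc _ _ _
  have e4 : a / t = (t / a)⁻¹ := (inv_div _ _).symm
  have hβ1 : q * (t / a)⁻¹ ∉ OmegaSet q :=
    not_mem_OmegaSet_of_zpow (mul_ne_zpow hq0 (inv_ne_zpow hta))
  have hβ2 : q * (t / a) ∉ OmegaSet q := not_mem_OmegaSet_of_zpow (mul_ne_zpow hq0 hta)
  have hz₁ : ‖Complex.exp (Complex.I * θ)‖ ≤ 1 := by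
    rw [mul_comm, Complex.norm_exp_ofReal_mul_I]
  have hz₂ : ‖Complex.exp (-(Complex.I * θ))‖ ≤ 1 := by
    have := Complex.norm_exp_ofReal_mul_I (-θ)
    rw [show -(Complex.I * θ) = ((-θ : ℝ) : ℂ) * Complex.I by push_cast; ring, this]
  simp only [contDualQHahn_cos, contDualQHahnTheta_eq_qDiff hq0 hq1, qHyp, e1, e2, e3, e4,
    qHypTerm_eq_phiCoeff]
  refine ⟨summable_phiCoeff_mul hq0 hq1 hβ1 hab hac _ _ _,
    summable_phiCoeff_mul hq0 hq1 hβ2 htb htc _ _ _, ?_⟩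
  have main := tsum_qDiff_qPoch (γ := γ) hq0 hq1 ha ht0 ht1 hta hab hac htb htc hz₁ hz₂
  convert hasSum_of_eq main fun n => ?_ using 1
  · simp only [qPochInfs, List.map_cons, List.map_nil, List.prod_cons, List.prod_nil]
    congr 2
    generalize qPochInf (a * b) q = A₁
    generalize qPochInf (t / a)⁻¹ q = A₂
    simp only [div_eq_mul_inv, mul_inv]
    ring
  · have h1 := qPoch_self_ne_zero hq1 n
    have h2 := qPoch_ne_zero hab n
    have h3 := qPoch_ne_zero hac n
    simp only [qPochs, List.map_cons, List.map_nil, List.prod_cons, List.prod_nil, mul_one,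
      div_pow]
    generalize qDiff q n _ 0 = D
    field_simp
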